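/- **Model.** $n$ users have independent, uniformly distributed positions in the unit square. The library has $m=m(n)$ files, where $m(n)\to\infty$ and $m(n)=o(n)$ as $n\to\infty$. Each user caches one file. A caching policy chooses the files cached by all users jointly; the choice may be random and may depend on all positions. Each user requests one file; requests are independent of each other and of the positions and caches, and file $i$ is requested with probability $f_i=i^{-\gamma_r}/\sum_{j=1}^m j^{-\gamma_r}$, $1\le i\le m$. Given a collaboration distance $r$, a link from a user $u$ (transmitter) to a user $v\neq u$ (receiver) is potentially active if $\|u-v\|<r$, $u$ caches the file that $v$ requests, and $v$ does not cache that file itself. Two different links conflict if the transmitter of one of them is within distance $r$ of the receiver of the other. $L$ is the maximum number of pairwise non-conflicting potentially active links. **Theorem.** Let $0\le\gamma_r<1$ and $\eta=\frac{1-\gamma_r}{2-\gamma_r}$. i) *Upper bound.* For any collaboration distance $r(n)$ and any caching policy, $E[L]=O\!\left(\frac{n}{m^{\eta}}\right)$, with a constant that depends neither on $n$, nor on $r(n)$, nor on the policy. ii) *Achievability.* Let $0<\epsilon<\frac16$. The equation $$\frac{(1-\gamma_r)\gamma_c}{1-\gamma_r+\gamma_c}=\eta+\epsilon$$ has a solution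 $\gamma_c>0$ if and only if $\eta+\epsilon<1-\gamma_r$. If $\gamma_c>0$ is a solution, if the users cache independently of each other and of the positions, file $i$ with probability $i^{-\gamma_c}/\sum_{j=1}^m j^{-\gamma_c}$, and if $c_3\sqrt{\frac{m^{\eta+\epsilon}}{n}}\le r(n)\le c_4\sqrt{\frac{m^{\eta+\epsilon}}{n}}$ for all large $n$, where $c_3,c_4>0$ are constants, then $E[L]=\Theta\!\left(\frac{n}{m^{\eta+\epsilon}}\right)$, with constants that do not depend on $n$ or on the choice of $r(n)$ within these bounds. -/

import Mathlib

open Filter MeasureTheory ProbabilityTheory Asymptotics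

noncomputable section

/-- The Euclidean plane. -/
abbrev Plane : Type := EuclideanSpace ℝ (Fin 2)

/-- The square cell of side `1`. -/
def unitCell : Set Plane := {x | ∀ i, x i ∈ Set.Icc (0 : ℝ) 1}

/-- The law of the position of one user: uniform on the cell. -/
def positionLaw : Measure Plane := volume.restrict unitCell

/-- Zipf probability of the file of rank `i + 1` in a library of `m` files. -/
def zipf (γ : ℝ) (m : ℕ) (i : Fin m) : ℝ :=
  (1 / ((i : ℝ) + 1) ^ γ) / ∑ j : Fin m, 1 / ((j : ℝ) + 1) ^ γ

/-- The Zipf distribution on a library of `m` files. -/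
def zipfLaw (γ : ℝ) (m : ℕ) : Measure (Fin m) :=
  ∑ i : Fin m, ENNReal.ofReal (zipf γ m i) • Measure.dirac i

/-- A possible D2D link is an ordered pair of users: (transmitter, receiver). -/
abbrev Link (n : ℕ) : Type := Fin n × Fin n

/-- The potentially active links, for users at `x` caching `w` and requesting `f`: the two users are
distinct and closer than `r`, the transmitter caches the file that the receiver requests, and the
receiver does not find that file in its own cache. -/
def potentialLinks {n m : ℕ} (r : ℝ) (x : Fin n → Plane) (w f : Fin n → Fin m) : Set (Link n) :=
  {l | l.1 ≠ l.2 ∧ dist (x l.1) (x l.2) < r ∧ w l.1 = f l.2 ∧ w l.2 ≠ f l.2}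

/-- The conflict graph of the protocol model: two different links interfere if the transmitter of
one of them is within range `r` of the receiver of the other. -/
def conflictGraph {n : ℕ} (r : ℝ) (x : Fin n → Plane) : SimpleGraph (Link n) where
  Adj a b := a ≠ b ∧ (dist (x a.1) (x b.2) ≤ r ∨ dist (x b.1) (x a.2) ≤ r)
  symm := ⟨fun _ _ h => ⟨h.1.symm, h.2.symm⟩⟩
  loopless := ⟨fun _ h => h.1 rfl⟩

/-- The number of active links: the largest size of a set of potentially active links
that is independent in the conflict graph. -/
def numActiveLinks {n m : ℕ} (r : ℝ) (x : Fin n → Plane) (w f : Fin n → Fin m) : ℕ :=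
  ((conflictGraph r x).induce (potentialLinks r x w f)).indepNum

/-- A caching policy for `n` users and `m` files: a (randomized) choice of the file in the cache of
each user, jointly for all users and possibly depending on the positions of all users. -/
abbrev CachingPolicy (n m : ℕ) : Type := Kernel (Fin n → Plane) (Fin n → Fin m)

/-- Users cache independently of each other and of the positions, by a Zipf distribution. -/
def zipfCaching (n m : ℕ) (γ : ℝ) : CachingPolicy n m :=
  Kernel.const _ (Measure.pi fun _ => zipfLaw γ m)

/-- The joint law of ((positions, caches), requests): positions are independent and uniform, caches
follow the policy, and requests are independent Zipf variables, independent of the rest. -/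
def networkLaw {n m : ℕ} (γr : ℝ) (κ : CachingPolicy n m) :
    Measure (((Fin n → Plane) × (Fin n → Fin m)) × (Fin n → Fin m)) :=
  ((Measure.pi fun _ => positionLaw) ⊗ₘ κ).prod (Measure.pi fun _ => zipfLaw γr m)

/-- The expected number of active links. -/
def expectedActiveLinks {n m : ℕ} (γr r : ℝ) (κ : CachingPolicy n m) : ℝ :=
  ∫ ω, (numActiveLinks r ω.1.1 ω.1.2 ω.2 : ℝ) ∂(networkLaw γr κ)

instance : IsProbabilityMeasure positionLaw := by
  constructor
  have h : unitCell = (MeasurableEquiv.toLp 2 (Fin 2 → ℝ)).symm ⁻¹'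
      (Set.univ.pi fun _ => Set.Icc (0 : ℝ) 1) := by
    ext x; simp only [unitCell, Set.mem_ofPred_eq, Set.mem_preimage, Set.mem_pi, Set.mem_univ, true_imp_iff]
    rfl
  rw [positionLaw, Measure.restrict_apply_univ, h,
    (EuclideanSpace.volume_preserving_symm_measurableEquiv_toLp (Fin 2)).measure_preimage
      (MeasurableSet.univ_pi fun _ => measurableSet_Icc).nullMeasurableSet,
    volume_pi_pi]
  simp

instance (γ : ℝ) (m : ℕ) [NeZero m] : IsProbabilityMeasure (zipfLaw γ m) := by
  have hp : ∀ i : Fin m, 0 < 1 / ((i : ℝ) + 1) ^ γ := fun i => by positivity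
  have hs : 0 < ∑ j : Fin m, 1 / ((j : ℝ) + 1) ^ γ :=
    Finset.sum_pos (fun i _ => hp i) Finset.univ_nonempty
  constructor
  simp only [zipfLaw, Measure.coe_finsetSum, Finset.sum_apply, Measure.smul_apply, measure_univ,
    smul_eq_mul, mul_one]
  rw [← ENNReal.ofReal_sum_of_nonneg (fun i _ => (show 0 ≤ zipf γ m i from (div_pos (hp i) hs).le))]
  simp only [zipf]
  rw [← Finset.sum_div, div_self hs.ne', ENNReal.ofReal_one]

instance (n m : ℕ) (γ : ℝ) [NeZero m] : IsMarkovKernel (zipfCaching n m γ) := by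
  unfold zipfCaching; infer_instance

theorem measurable_numActiveLinks {n m : ℕ} (r : ℝ) :
    Measurable fun ω : ((Fin n → Plane) × (Fin n → Fin m)) × (Fin n → Fin m) =>
      numActiveLinks r ω.1.1 ω.1.2 ω.2 := by
  let code : ((Fin n → Plane) × (Fin n → Fin m)) × (Fin n → Fin m) →
      ((Link n → Prop) × (Link n → Prop)) × (Fin n → Fin m) × (Fin n → Fin m) := fun ω =>
    ((fun l => dist (ω.1.1 l.1) (ω.1.1 l.2) < r, fun l => dist (ω.1.1 l.1) (ω.1.1 l.2) ≤ r),
      ω.1.2, ω.2)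
  have hcode : Measurable code := by
    have hd : ∀ l : Link n, Measurable
        fun ω : ((Fin n → Plane) × (Fin n → Fin m)) × (Fin n → Fin m) =>
          dist (ω.1.1 l.1) (ω.1.1 l.2) := fun l => by
      have h1 : ∀ i : Fin n, Measurable
          fun ω : ((Fin n → Plane) × (Fin n → Fin m)) × (Fin n → Fin m) => ω.1.1 i := fun i =>
        (measurable_pi_apply i).comp (measurable_fst.comp measurable_fst)
      exact (h1 l.1).dist (h1 l.2)
    refine Measurable.prodMk (Measurable.prodMk ?_ ?_)
      ((measurable_snd.comp measurable_fst).prodMk measurable_snd)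
    · exact measurable_pi_iff.2 fun l =>
        measurableSet_setOfPred.1 (measurableSet_lt (hd l) measurable_const)
    · exact measurable_pi_iff.2 fun l =>
        measurableSet_setOfPred.1 (measurableSet_le (hd l) measurable_const)
  have hf : Function.FactorsThrough
      (fun ω : ((Fin n → Plane) × (Fin n → Fin m)) × (Fin n → Fin m) =>
        numActiveLinks r ω.1.1 ω.1.2 ω.2) code := by
    rintro ⟨⟨x, w⟩, f⟩ ⟨⟨x', w'⟩, f'⟩ h
    simp only [code, Prod.mk.injEq] at h
    obtain ⟨⟨h1, h2⟩, rfl, rfl⟩ := h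
    have h1' : ∀ i j, (dist (x i) (x j) < r) = (dist (x' i) (x' j) < r) :=
      fun i j => congrFun h1 (i, j)
    have h2' : ∀ i j, (dist (x i) (x j) ≤ r) = (dist (x' i) (x' j) ≤ r) :=
      fun i j => congrFun h2 (i, j)
    have hG : conflictGraph r x = conflictGraph r x' := by
      ext a b; simp only [conflictGraph, h2']
    have hS : potentialLinks r x w f = potentialLinks r x' w f := by
      ext l; simp only [potentialLinks, Set.mem_ofPred_eq, h1']
    simp only [numActiveLinks]
    rw [hG, hS]
  rw [← hf.extend_comp (fun _ => 0)]
  exact (Measurable.of_discrete).comp hcode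

end

/-! Upper bound. Cut the cell into `g ^ 2 ≈ n / M` squares of mesh `1 / g`, where `M = m ^ η`, so
that a square holds about `M` users. Whatever the policy, these cache at most about `M` files, and
any `M` files together are requested with probability `O((M / m) ^ (1 - γr))` (`sum_zipf_le`). Since
`η` solves `M * (M / m) ^ (1 - γr) = 1`, the number `X` of requests in one square for files cached
in another has bounded moments (`integral_gridHits_le`, `integral_exp_usersIn_le`).

It remains to count pairs of squares. With `K = r * g ≥ 1` there are `O(g ^ 2 * K ^ 2)` pairs within
range, but non-interfering links occupy only `O(g ^ 2 / K)` of them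
(`NonInterfering.card_image_gridPair_le`). The occupied pairs depend on the requests, so means
cannot simply be added over them. The truncation `X ≤ K + X ^ 3 / K ^ 2` avoids this: `K` is summed
over occupied pairs only, the cubic term over all pairs in range, and both sums are `O(g ^ 2)` in
the mean (`exists_numActiveLinks_le_sum_gridHits`).

The packing bound is planar geometry. Sort links by the squares of mesh `ρ = r / 20` that contain
their ends; there are `O(1 / r ^ 2)` such classes. For two long non-interfering links of one class,
the displacements of transmitters and of receivers are nearly orthogonal to the common direction and
point to the same side (`NonInterfering.cross_bounds`). Hence the class is essentially
one-dimensional and occupies `O(r / s)` pairs of squares of mesh `s`, not `O((r / s) ^ 4)`.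

Achievability. Put `θ = η + ε` and now `M = m ^ θ`, the order of the number of users in range. Files
of rank about `q = M ^ (1 / γc)` are cached about once among `M` users. The equation for `γc` says
exactly that the files up to rank `q` are requested with probability of order `1 / M`
(`rpow_cutoff`), so `M` users make about one request that can be served. For the upper estimate,
requests for ranks below `q` are all counted, and the remaining ones are bounded by a first moment
(`expectedActiveLinks_zipfCaching_le`). For the lower estimate, about `1 / r ^ 2` well separated
squares each contain a link with probability bounded below (`le_expectedActiveLinks_zipfCaching`).
-/

noncomputable section

/-! ### Estimates for Zipf sums. -/

section ZipfSums

/-- Bernoulli's inequality at `-1 / (k + 1)` with exponent `1 - γ`. It replaces the comparison with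
the integral of `t ^ (-γ)`, and the right side telescopes. -/
theorem one_div_rpow_le_sub {γ : ℝ} (h0 : 0 ≤ γ) (h1 : γ < 1) (k : ℕ) :
    (1 - γ) * (1 / ((k : ℝ) + 1) ^ γ) ≤ ((k : ℝ) + 1) ^ (1 - γ) - (k : ℝ) ^ (1 - γ) := by
  have hk : (0 : ℝ) < (k : ℝ) + 1 := by positivity
  have hb := rpow_one_add_le_one_add_mul_self (s := -(1 / ((k : ℝ) + 1))) (p := 1 - γ)
    (by rw [neg_le_neg_iff, div_le_one hk]; linarith [k.cast_nonneg (α := ℝ)]) (by linarith)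
    (by linarith)
  have e1 : 1 + -(1 / ((k : ℝ) + 1)) = k / ((k : ℝ) + 1) := by field_simp; ring
  rw [e1, Real.div_rpow k.cast_nonneg hk.le, div_le_iff₀ (by positivity)] at hb
  have e2 : ((k : ℝ) + 1) ^ (1 - γ) = ((k : ℝ) + 1) * (1 / ((k : ℝ) + 1) ^ γ) := by
    rw [Real.rpow_sub hk, Real.rpow_one]; ring
  have e3 : (1 + (1 - γ) * -(1 / ((k : ℝ) + 1))) * ((k : ℝ) + 1) ^ (1 - γ) =
      ((k : ℝ) + 1) ^ (1 - γ) - (1 - γ) * (1 / ((k : ℝ) + 1) ^ γ) := by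
    rw [e2]; field_simp; ring
  linarith

theorem sum_range_one_div_rpow_le {γ : ℝ} (h0 : 0 ≤ γ) (h1 : γ < 1) (k : ℕ) :
    ∑ j ∈ Finset.range k, 1 / ((j : ℝ) + 1) ^ γ ≤ (k : ℝ) ^ (1 - γ) / (1 - γ) := by
  rw [le_div_iff₀ (by linarith)]
  induction k with
  | zero => simp [Real.zero_rpow (by linarith : (1 - γ) ≠ 0)]
  | succ k ih =>
    rw [Finset.sum_range_succ, add_mul]
    have := one_div_rpow_le_sub h0 h1 k
    push_cast
    linarith

/-- The telescoping step for tails. The exponent `1 - β` is negative, so Bernoulli's inequality is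
replaced by `log x ≤ x - 1` and `1 + x ≤ exp x`. -/
theorem one_div_rpow_le_sub_of_one_lt {β : ℝ} (h1 : 1 < β) {k : ℕ} (hk : 1 ≤ k) :
    (β - 1) * (1 / ((k : ℝ) + 1) ^ β) ≤ (k : ℝ) ^ (1 - β) - ((k : ℝ) + 1) ^ (1 - β) := by
  have hk0 : (0 : ℝ) < k := by exact_mod_cast hk
  have hk1 : (0 : ℝ) < (k : ℝ) + 1 := by positivity
  have hlog : Real.log (k / ((k : ℝ) + 1)) ≤ -(1 / ((k : ℝ) + 1)) := by
    refine (Real.log_le_sub_one_of_pos (by positivity)).trans (le_of_eq ?_)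
    field_simp; ring
  have hb : 1 + (β - 1) * (1 / ((k : ℝ) + 1)) ≤ (k / ((k : ℝ) + 1)) ^ (1 - β) := by
    rw [Real.rpow_def_of_pos (by positivity)]
    refine le_trans ?_ (Real.add_one_le_exp _)
    nlinarith
  rw [Real.div_rpow hk0.le hk1.le, le_div_iff₀ (by positivity)] at hb
  have e2 : ((k : ℝ) + 1) ^ (1 - β) = ((k : ℝ) + 1) * (1 / ((k : ℝ) + 1) ^ β) := by
    rw [Real.rpow_sub hk1, Real.rpow_one]; ring
  have e3 : (1 + (β - 1) * (1 / ((k : ℝ) + 1))) * ((k : ℝ) + 1) ^ (1 - β) =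
      ((k : ℝ) + 1) ^ (1 - β) + (β - 1) * (1 / ((k : ℝ) + 1) ^ β) := by
    rw [e2]; field_simp
  linarith

theorem sum_Ico_one_div_rpow_le {β : ℝ} (h1 : 1 < β) {k : ℕ} (hk : 1 ≤ k) (m : ℕ) :
    ∑ j ∈ Finset.Ico k m, 1 / ((j : ℝ) + 1) ^ β ≤ (k : ℝ) ^ (1 - β) / (β - 1) := by
  rw [le_div_iff₀ (by linarith)]
  rcases le_total m k with h | h
  · simp only [Finset.Ico_eq_empty_of_le h, Finset.sum_empty, zero_mul]; positivity
  suffices H : (∑ j ∈ Finset.Ico k m, 1 / ((j : ℝ) + 1) ^ β) * (β - 1) ≤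
      (k : ℝ) ^ (1 - β) - (m : ℝ) ^ (1 - β) by
    have : 0 ≤ (m : ℝ) ^ (1 - β) := by positivity
    linarith
  induction m, h using Nat.le_induction with
  | base => simp
  | succ m hm ih =>
    rw [Finset.sum_Ico_succ_top hm, add_mul]
    have := one_div_rpow_le_sub_of_one_lt h1 (hk.trans hm)
    push_cast
    linarith

theorem zipf_nonneg (γ : ℝ) (m : ℕ) (i : Fin m) : 0 ≤ zipf γ m i := by
  unfold zipf; positivity

theorem zipf_denom_pos (γ : ℝ) (m : ℕ) [NeZero m] :
    0 < ∑ j : Fin m, 1 / ((j : ℝ) + 1) ^ γ :=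
  Finset.sum_pos (fun i _ => by positivity) Finset.univ_nonempty

theorem sum_zipf (γ : ℝ) (m : ℕ) [NeZero m] : ∑ i, zipf γ m i = 1 := by
  simp only [zipf]
  rw [← Finset.sum_div, div_self (zipf_denom_pos γ m).ne']

theorem le_zipf_denom {γ : ℝ} (h0 : 0 ≤ γ) (m : ℕ) [NeZero m] :
    (m : ℝ) ^ (1 - γ) ≤ ∑ j : Fin m, 1 / ((j : ℝ) + 1) ^ γ := by
  have hm : (0 : ℝ) < m := by exact_mod_cast NeZero.pos m
  have : ∑ j : Fin m, 1 / (m : ℝ) ^ γ ≤ ∑ j : Fin m, 1 / ((j : ℝ) + 1) ^ γ := by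
    refine Finset.sum_le_sum fun j _ => one_div_le_one_div_of_le (by positivity) ?_
    exact Real.rpow_le_rpow (by positivity) (by exact_mod_cast j.2) h0
  refine le_trans (le_of_eq ?_) this
  rw [Finset.sum_const, Finset.card_univ, Fintype.card_fin, nsmul_eq_mul, Real.rpow_sub hm,
    Real.rpow_one]
  ring

theorem zipf_denom_le {γ : ℝ} (h0 : 0 ≤ γ) (h1 : γ < 1) (m : ℕ) :
    ∑ j : Fin m, 1 / ((j : ℝ) + 1) ^ γ ≤ (m : ℝ) ^ (1 - γ) / (1 - γ) := by
  rw [Fin.sum_univ_eq_sum_range (fun j : ℕ => 1 / ((j : ℝ) + 1) ^ γ) m]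
  exact sum_range_one_div_rpow_le h0 h1 m

theorem one_le_zipf_denom (γ : ℝ) (m : ℕ) [NeZero m] :
    1 ≤ ∑ j : Fin m, 1 / ((j : ℝ) + 1) ^ γ := by
  have := Finset.single_le_sum (f := fun j : Fin m => 1 / ((j : ℝ) + 1) ^ γ)
    (fun i _ => by positivity) (Finset.mem_univ 0)
  simpa using this

theorem zipf_denom_le_of_one_lt {γ : ℝ} (h1 : 1 < γ) (m : ℕ) [NeZero m] :
    ∑ j : Fin m, 1 / ((j : ℝ) + 1) ^ γ ≤ 1 + 1 / (γ - 1) := by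
  rw [Fin.sum_univ_eq_sum_range (fun j : ℕ => 1 / ((j : ℝ) + 1) ^ γ) m, Finset.range_eq_Ico,
    Finset.sum_eq_sum_Ico_succ_bot (NeZero.pos m)]
  have := sum_Ico_one_div_rpow_le h1 le_rfl m
  simp only [Nat.cast_zero, zero_add, Real.one_rpow, Nat.cast_one] at this ⊢
  linarith

/-- Zipf mass of a set of files, compared with that of the `k` most popular ones. -/
theorem sum_zipf_le {γ : ℝ} (h0 : 0 ≤ γ) (h1 : γ < 1) (m : ℕ) [NeZero m] {k : ℕ} (hk : 1 ≤ k)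
    (W : Finset (Fin m)) :
    ∑ i ∈ W, zipf γ m i ≤ 1 / (1 - γ) * ((k : ℝ) / m) ^ (1 - γ) * (1 + W.card / k) := by
  have hm : (0 : ℝ) < m := by exact_mod_cast NeZero.pos m
  have hk0 : (0 : ℝ) < k := by exact_mod_cast hk
  have hγ : 0 < 1 - γ := by linarith
  have key : ∑ i ∈ W, 1 / ((i : ℝ) + 1) ^ γ ≤
      (k : ℝ) ^ (1 - γ) / (1 - γ) + W.card * (1 / (k : ℝ) ^ γ) := by
    -- Ranks below `k` contribute at most the full initial sum; each other file of `W` weighs at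
    -- most `k ^ (-γ)`.
    rw [← Finset.sum_filter_add_sum_filter_not W (fun i : Fin m => (i : ℕ) < k)]
    refine add_le_add ?_ ?_
    · refine le_trans ?_ (sum_range_one_div_rpow_le h0 h1 k)
      refine le_trans (le_of_eq (Finset.sum_map (W.filter fun i : Fin m => (i : ℕ) < k)
        Fin.valEmbedding (fun j : ℕ => 1 / ((j : ℝ) + 1) ^ γ)).symm) ?_
      refine Finset.sum_le_sum_of_subset_of_nonneg ?_ (fun _ _ _ => by positivity)
      intro j hj
      simp only [Finset.mem_map, Finset.mem_filter] at hj
      obtain ⟨i, ⟨_, h⟩, rfl⟩ := hj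
      exact Finset.mem_range.2 h
    · refine (Finset.sum_le_card_nsmul _ _ (1 / (k : ℝ) ^ γ) fun i hi => ?_).trans ?_
      · have : k ≤ (i : ℕ) := by simpa using (Finset.mem_filter.1 hi).2
        have : (k : ℝ) ≤ (i : ℕ) := by exact_mod_cast this
        exact one_div_le_one_div_of_le (by positivity)
          (Real.rpow_le_rpow hk0.le (by linarith) h0)
      · rw [nsmul_eq_mul]
        gcongr
        exact Finset.filter_subset _ _
  have h2 : (k : ℝ) ^ (1 - γ) / (1 - γ) + W.card * (1 / (k : ℝ) ^ γ) ≤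
      1 / (1 - γ) * (k : ℝ) ^ (1 - γ) * (1 + W.card / k) := by
    have e : (k : ℝ) ^ (1 - γ) = k * (1 / (k : ℝ) ^ γ) := by
      rw [Real.rpow_sub hk0, Real.rpow_one]; ring
    have e3 : 1 / (1 - γ) * (k : ℝ) ^ (1 - γ) * (1 + W.card / k) =
      (k : ℝ) ^ (1 - γ) / (1 - γ) + 1 / (1 - γ) * (W.card * (1 / (k : ℝ) ^ γ)) := by
      rw [e]; field_simp
    rw [e3]
    have : 1 ≤ 1 / (1 - γ) := by rw [le_div_iff₀ hγ]; linarith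
    have h3 : 0 ≤ (W.card : ℝ) * (1 / (k : ℝ) ^ γ) := by positivity
    nlinarith
  simp only [zipf]
  rw [← Finset.sum_div, Real.div_rpow hk0.le hm.le, div_le_iff₀ (zipf_denom_pos γ m)]
  refine (key.trans h2).trans ?_
  have hd := le_zipf_denom h0 m
  have hmp : 0 < (m : ℝ) ^ (1 - γ) := by positivity
  have e4 : 1 / (1 - γ) * ((k : ℝ) ^ (1 - γ) / (m : ℝ) ^ (1 - γ)) * (1 + W.card / k) *
      ∑ j : Fin m, 1 / ((j : ℝ) + 1) ^ γ = 1 / (1 - γ) * (k : ℝ) ^ (1 - γ) * (1 + W.card / k) *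
      ((∑ j : Fin m, 1 / ((j : ℝ) + 1) ^ γ) / (m : ℝ) ^ (1 - γ)) := by ring
  rw [e4]
  exact le_mul_of_one_le_right (by positivity) ((one_le_div hmp).2 hd)

theorem zipfLaw_apply (γ : ℝ) (m : ℕ) (A : Set (Fin m)) [DecidablePred (· ∈ A)] :
    zipfLaw γ m A = ENNReal.ofReal (∑ i with i ∈ A, zipf γ m i) := by
  classical
  rw [ENNReal.ofReal_sum_of_nonneg fun i _ => zipf_nonneg γ m i, Finset.sum_filter]
  simp only [zipfLaw, Measure.coe_finsetSum, Finset.sum_apply, Measure.smul_apply, smul_eq_mul,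
    Measure.dirac_apply, Set.indicator_apply, Pi.one_apply, mul_ite, mul_one, mul_zero]

end ZipfSums

/-! ### Planar packing of non-interfering links. -/

section Packing

/-- Index of the square of a grid with mesh `s` that contains `y`. -/
def gridIndex (s : ℝ) (y : Plane) : ℤ × ℤ := (⌊y 0 / s⌋, ⌊y 1 / s⌋)

/-- The grid squares at distance at most `k` from `c` in both directions. -/
def gridBox (k : ℕ) (c : ℤ × ℤ) : Finset (ℤ × ℤ) :=
  Finset.Icc (c.1 - k) (c.1 + k) ×ˢ Finset.Icc (c.2 - k) (c.2 + k)

theorem card_gridBox (k : ℕ) (c : ℤ × ℤ) : (gridBox k c).card = (2 * k + 1) ^ 2 := by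
  rw [gridBox, Finset.card_product, Int.card_Icc, Int.card_Icc, sq]
  congr 1 <;> omega

theorem floor_mem_Icc_of_abs_sub_lt {x y : ℝ} {k : ℕ} (h : |x - y| < k) :
    ⌊x⌋ ∈ Finset.Icc (⌊y⌋ - (k : ℤ)) (⌊y⌋ + k) := by
  obtain ⟨h1, h2⟩ := abs_lt.1 h
  have a1 := Int.floor_le x
  have a2 := Int.lt_floor_add_one x
  have a3 := Int.floor_le y
  have a4 := Int.lt_floor_add_one y
  have b1 : ((⌊y⌋ - k : ℤ) : ℝ) < ((⌊x⌋ + 1 : ℤ) : ℝ) := by push_cast; linarith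
  have b2 : ((⌊x⌋ : ℤ) : ℝ) < ((⌊y⌋ + k + 1 : ℤ) : ℝ) := by push_cast; linarith
  have b1 := Int.cast_lt.1 b1
  have b2 := Int.cast_lt.1 b2
  rw [Finset.mem_Icc]
  omega

theorem gridIndex_mem_gridBox {s : ℝ} (hs : 0 < s) {y z : Plane} {k : ℕ}
    (h0 : |y 0 - z 0| < k * s) (h1 : |y 1 - z 1| < k * s) :
    gridIndex s y ∈ gridBox k (gridIndex s z) := by
  refine Finset.mem_product.2 ⟨floor_mem_Icc_of_abs_sub_lt ?_, floor_mem_Icc_of_abs_sub_lt ?_⟩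
  · rwa [← sub_div, abs_div, abs_of_pos hs, div_lt_iff₀ hs]
  · rwa [← sub_div, abs_div, abs_of_pos hs, div_lt_iff₀ hs]

theorem abs_sub_lt_of_gridIndex_eq {s : ℝ} (hs : 0 < s) {y z : Plane}
    (h : gridIndex s y = gridIndex s z) (i : Fin 2) : |y i - z i| < s := by
  have key : ∀ u v : ℝ, ⌊u / s⌋ = ⌊v / s⌋ → |u - v| < s := fun u v huv => by
    have := Int.abs_sub_lt_one_of_floor_eq_floor huv
    rwa [← sub_div, abs_div, abs_of_pos hs, div_lt_one hs] at this
  simp only [gridIndex, Prod.mk.injEq] at h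
  fin_cases i
  · exact key _ _ h.1
  · exact key _ _ h.2

theorem dist_sq_plane (x y : Plane) : dist x y ^ 2 = (x 0 - y 0) ^ 2 + (x 1 - y 1) ^ 2 := by
  rw [EuclideanSpace.dist_eq, Real.sq_sqrt (by positivity), Fin.sum_univ_two, Real.dist_eq,
    Real.dist_eq, sq_abs, sq_abs]

theorem abs_sub_le_dist (x y : Plane) (i : Fin 2) : |x i - y i| ≤ dist x y := by
  refine abs_le_of_sq_le_sq ?_ dist_nonneg
  rw [dist_sq_plane]
  fin_cases i <;> simp <;> positivity

/-- If moving by `v` leaves one ball around the end of `d` and moving by `-v` leaves one around the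
end of `d'`, where `d` and `d'` are close to `e`, then `v` is nearly orthogonal to `e`. -/
theorem dot_sq_lt_cross_sq {ρ e0 e1 d0 d1 d0' d1' v0 v1 : ℝ} (hρ : 0 < ρ)
    (he : (10 * ρ) ^ 2 ≤ e0 ^ 2 + e1 ^ 2)
    (hd : (d0 - e0) ^ 2 + (d1 - e1) ^ 2 ≤ (4 * ρ) ^ 2)
    (hd' : (d0' - e0) ^ 2 + (d1' - e1) ^ 2 ≤ (4 * ρ) ^ 2)
    (hv : v0 ^ 2 + v1 ^ 2 ≤ (2 * ρ) ^ 2)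
    (h1 : d0 ^ 2 + d1 ^ 2 < (d0 - v0) ^ 2 + (d1 - v1) ^ 2)
    (h2 : d0' ^ 2 + d1' ^ 2 < (d0' + v0) ^ 2 + (d1' + v1) ^ 2) :
    3 * (v0 * e0 + v1 * e1) ^ 2 < (v1 * e0 - v0 * e1) ^ 2 := by
  obtain ⟨N, hN0, hN⟩ : ∃ N : ℝ, 0 ≤ N ∧ N ^ 2 = v0 ^ 2 + v1 ^ 2 :=
    ⟨√(v0 ^ 2 + v1 ^ 2), Real.sqrt_nonneg _, Real.sq_sqrt (by positivity)⟩
  have hN2 : N ≤ 2 * ρ := by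
    refine abs_le_of_sq_le_sq' ?_ (by positivity) |>.2
    rw [hN]; exact hv
  have cs : ∀ p q : ℝ, p ^ 2 + q ^ 2 ≤ (4 * ρ) ^ 2 → |p * v0 + q * v1| ≤ 4 * ρ * N := by
    intro p q h
    refine abs_le_of_sq_le_sq ?_ (by positivity)
    have : (p * v0 + q * v1) ^ 2 ≤ (p ^ 2 + q ^ 2) * (v0 ^ 2 + v1 ^ 2) := by
      nlinarith [sq_nonneg (p * v1 - q * v0)]
    calc _ ≤ (p ^ 2 + q ^ 2) * (v0 ^ 2 + v1 ^ 2) := this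
      _ ≤ (4 * ρ) ^ 2 * N ^ 2 := by rw [hN]; gcongr
      _ = _ := by ring
  have c1 := (abs_le.1 (cs _ _ hd)).1
  have c2 := (abs_le.1 (cs _ _ hd')).2
  -- Expanding `h1` and `h2` bounds the products of `v` with `d` and `-d'` by `N ^ 2 / 2 ≤ ρ * N`.
  -- Replacing `d`, `d'` by `e` costs `4 * ρ * N`, hence `5 * ρ * N`: at most half of the length of
  -- `e` times `N`.
  have hNρ : N ^ 2 ≤ 2 * ρ * N := by rw [sq]; exact mul_le_mul_of_nonneg_right hN2 hN0
  have u1 : v0 * e0 + v1 * e1 < 5 * ρ * N := by linarith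
  have u2 : -(5 * ρ * N) < v0 * e0 + v1 * e1 := by linarith
  have u3 : (v0 * e0 + v1 * e1) ^ 2 < (5 * ρ * N) ^ 2 := sq_lt_sq' u2 u1
  have id : (v0 * e0 + v1 * e1) ^ 2 + (v1 * e0 - v0 * e1) ^ 2 =
    (e0 ^ 2 + e1 ^ 2) * N ^ 2 := by rw [hN]; ring
  have u4 : (10 * ρ) ^ 2 * N ^ 2 ≤ (e0 ^ 2 + e1 ^ 2) * N ^ 2 := by gcongr
  linarith

/-- In the orthogonal frame along `e`, the inner product of `p` and `q` is, up to a positive factor,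
`P * Q + P' * Q'`. The cross components dominate, so its sign is that of `P' * Q'`. -/
theorem cross_mul_cross_pos {e0 e1 p0 p1 q0 q1 : ℝ}
    (hp : 3 * (p0 * e0 + p1 * e1) ^ 2 < (p1 * e0 - p0 * e1) ^ 2)
    (hq : 3 * (q0 * e0 + q1 * e1) ^ 2 < (q1 * e0 - q0 * e1) ^ 2)
    (hpq : 0 < p0 * q0 + p1 * q1) :
    0 < (p1 * e0 - p0 * e1) * (q1 * e0 - q0 * e1) := by
  set P := p0 * e0 + p1 * e1
  set Q := q0 * e0 + q1 * e1
  set P' := p1 * e0 - p0 * e1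
  set Q' := q1 * e0 - q0 * e1
  have he : 0 < e0 ^ 2 + e1 ^ 2 := by
    by_contra h
    have h0 : e0 = 0 := by nlinarith [sq_nonneg e0, sq_nonneg e1]
    have h1 : e1 = 0 := by nlinarith [sq_nonneg e0, sq_nonneg e1]
    simp [P, P', h0, h1] at hp
  have id : P * Q + P' * Q' = (e0 ^ 2 + e1 ^ 2) * (p0 * q0 + p1 * q1) := by
    simp only [P, Q, P', Q']; ring
  have hpos : 0 < P * Q + P' * Q' := by rw [id]; positivity
  by_contra h
  push Not at h
  have h9 : 9 * (P * Q) ^ 2 ≤ (P' * Q') ^ 2 := by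
    have := mul_le_mul hp.le hq.le (by positivity) (by positivity)
    nlinarith
  nlinarith [mul_pos hpos hpos]

theorem card_le_mul_card_of_fiber {ι κ : Type*} [DecidableEq κ] {S : Finset ι} {t : Finset κ}
    (f : ι → κ) (hf : ∀ a ∈ S, f a ∈ t) {B : ℝ}
    (hB : ∀ b ∈ t, ((S.filter fun a => f a = b).card : ℝ) ≤ B) :
    (S.card : ℝ) ≤ B * t.card := by
  rw [Finset.card_eq_sum_card_fiberwise hf]
  push_cast
  calc _ ≤ ∑ _b ∈ t, B := Finset.sum_le_sum hB
    _ = _ := by rw [Finset.sum_const, nsmul_eq_mul, mul_comm]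

variable {ι : Type*} {a b : ι → Plane} {r s ρ : ℝ} {S : Finset ι}

/-- Grid squares of transmitters and receivers of a family of links. -/
def gridPair (s : ℝ) (a b : ι → Plane) (l : ι) : (ℤ × ℤ) × (ℤ × ℤ) :=
  (gridIndex s (a l), gridIndex s (b l))

/-- Links that do not interfere: every receiver is in range of its own transmitter only. -/
def NonInterfering (r : ℝ) (a b : ι → Plane) (S : Finset ι) : Prop :=
  (∀ l ∈ S, dist (a l) (b l) < r) ∧ ∀ l ∈ S, ∀ l' ∈ S, l ≠ l' → r < dist (a l) (b l')

theorem NonInterfering.mono {S' : Finset ι} (h : NonInterfering r a b S) (hS : S' ⊆ S) :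
    NonInterfering r a b S' :=
  ⟨fun l hl => h.1 l (hS hl), fun l hl l' hl' => h.2 l (hS hl) l' (hS hl')⟩

/-- Each of the two links is shorter than `20 * ρ`, while both crossed distances exceed it. Taken
one at a time, the four comparisons feed `dot_sq_lt_cross_sq` for either displacement; added up,
they say that the displacements of transmitters and receivers have positive inner product. -/
theorem NonInterfering.cross_bounds (h : NonInterfering (20 * ρ) a b S) (hρ : 0 < ρ)
    (ha : ∀ l ∈ S, ∀ l' ∈ S, gridIndex ρ (a l) = gridIndex ρ (a l'))
    (hb : ∀ l ∈ S, ∀ l' ∈ S, gridIndex ρ (b l) = gridIndex ρ (b l'))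
    {l₀ l l' : ι} (hl₀ : l₀ ∈ S) (hl : l ∈ S) (hl' : l' ∈ S) (hne : l ≠ l')
    (hlong : 10 * ρ ≤ dist (a l₀) (b l₀)) {e0 e1 : ℝ} (he0 : e0 = b l₀ 0 - a l₀ 0)
    (he1 : e1 = b l₀ 1 - a l₀ 1) :
    3 * ((a l 0 - a l' 0) * e0 + (a l 1 - a l' 1) * e1) ^ 2 <
        ((a l 1 - a l' 1) * e0 - (a l 0 - a l' 0) * e1) ^ 2 ∧
      3 * ((b l 0 - b l' 0) * e0 + (b l 1 - b l' 1) * e1) ^ 2 <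
        ((b l 1 - b l' 1) * e0 - (b l 0 - b l' 0) * e1) ^ 2 ∧
      0 < ((a l 1 - a l' 1) * e0 - (a l 0 - a l' 0) * e1) *
        ((b l 1 - b l' 1) * e0 - (b l 0 - b l' 0) * e1) := by
  have lt_of : ∀ {w x y z : Plane}, dist w x < 20 * ρ → 20 * ρ < dist y z →
      (w 0 - x 0) ^ 2 + (w 1 - x 1) ^ 2 < (y 0 - z 0) ^ 2 + (y 1 - z 1) ^ 2 := by
    intro w x y z h1 h2
    rw [← dist_sq_plane, ← dist_sq_plane]
    exact pow_lt_pow_left₀ (h1.trans h2) dist_nonneg two_ne_zero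
  have k1 := lt_of (h.1 l hl) (h.2 l hl l' hl' hne)
  have k2 := lt_of (h.1 l hl) (h.2 l' hl' l hl hne.symm)
  have k3 := lt_of (h.1 l' hl') (h.2 l hl l' hl' hne)
  have k4 := lt_of (h.1 l' hl') (h.2 l' hl' l hl hne.symm)
  have he : (10 * ρ) ^ 2 ≤ e0 ^ 2 + e1 ^ 2 := by
    have := pow_le_pow_left₀ (by positivity) hlong 2
    rw [dist_sq_plane] at this
    rw [he0, he1]
    linarith
  have near : ∀ {p q : ι}, p ∈ S → q ∈ S → ∀ i : Fin 2,
      |a p i - a q i| < ρ ∧ |b p i - b q i| < ρ := fun hp hq i =>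
    ⟨abs_sub_lt_of_gridIndex_eq hρ (ha _ hp _ hq) i, abs_sub_lt_of_gridIndex_eq hρ (hb _ hp _ hq) i⟩
  have hsq : ∀ {x y c : ℝ}, |x| ≤ c → |y| ≤ c → x ^ 2 + y ^ 2 ≤ 2 * c ^ 2 := fun hx hy => by
    have := sq_le_sq.2 (hx.trans (le_abs_self _))
    have := sq_le_sq.2 (hy.trans (le_abs_self _))
    linarith
  have hde : ∀ {p : ι}, p ∈ S →
      ((b p 0 - a p 0) - e0) ^ 2 + ((b p 1 - a p 1) - e1) ^ 2 ≤ (4 * ρ) ^ 2 := by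
    intro p hp
    have hc : ∀ i : Fin 2, |(b p i - a p i) - (b l₀ i - a l₀ i)| ≤ 2 * ρ := fun i => by
      obtain ⟨u1, u2⟩ := near hp hl₀ i
      rw [abs_lt] at u1 u2
      rw [abs_le]
      constructor <;> linarith
    have := hsq (hc 0) (hc 1)
    rw [he0, he1]
    linarith [sq_nonneg ρ]
  have hα : (a l 0 - a l' 0) ^ 2 + (a l 1 - a l' 1) ^ 2 ≤ (2 * ρ) ^ 2 := by
    have := hsq (near hl hl' 0).1.le (near hl hl' 1).1.le
    linarith [sq_nonneg ρ]
  have hβ : (b l 0 - b l' 0) ^ 2 + (b l 1 - b l' 1) ^ 2 ≤ (2 * ρ) ^ 2 := by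
    have := hsq (near hl hl' 0).2.le (near hl hl' 1).2.le
    linarith [sq_nonneg ρ]
  have A := dot_sq_lt_cross_sq hρ he (hde hl') (hde hl) hα (by linarith) (by linarith)
  have B := dot_sq_lt_cross_sq hρ he (hde hl) (hde hl') hβ (by linarith) (by linarith)
  exact ⟨A, B, cross_mul_cross_pos A B (by linarith)⟩

/-- Non-interfering long links with nearly equal transmitters, receivers and offsets across their
common direction occupy boundedly many pairs of squares. -/
theorem NonInterfering.card_strip_le [DecidableEq ι] (h : NonInterfering (20 * ρ) a b S)
    (hρ : 0 < ρ) (hs : 0 < s)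
    (ha : ∀ l ∈ S, ∀ l' ∈ S, gridIndex ρ (a l) = gridIndex ρ (a l'))
    (hb : ∀ l ∈ S, ∀ l' ∈ S, gridIndex ρ (b l) = gridIndex ρ (b l'))
    {l₀ : ι} (hl₀ : l₀ ∈ S) (hlong : 10 * ρ ≤ dist (a l₀) (b l₀)) {e0 e1 E : ℝ}
    (he0 : e0 = b l₀ 0 - a l₀ 0) (he1 : e1 = b l₀ 1 - a l₀ 1)
    (hE0 : 0 < E) (hE : E ^ 2 = e0 ^ 2 + e1 ^ 2)
    {T : Finset ι} (hT : T ⊆ S) (hinj : Set.InjOn (gridPair s a b) T)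
    (ht : ∀ l ∈ T, ∀ l' ∈ T, |((a l 1 - a l' 1) * e0 - (a l 0 - a l' 0) * e1) +
        ((b l 1 - b l' 1) * e0 - (b l 0 - b l' 0) * e1)| < E * s) :
    T.card ≤ 625 := by
  rcases T.eq_empty_or_nonempty with rfl | ⟨l', hl'⟩
  · simp
  -- Near orthogonality lets the cross component control the whole vector: its squared length is
  -- less than `4 / 3 * s ^ 2`. This gives boxes of radius 2, and `625 = 25 * 25` pairs.
  have sub : ∀ {v0 v1 c : ℝ}, 3 * (v0 * e0 + v1 * e1) ^ 2 < (v1 * e0 - v0 * e1) ^ 2 →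
      |v1 * e0 - v0 * e1| ≤ |c| → |c| < E * s → |v0| < (2 : ℕ) * s ∧ |v1| < (2 : ℕ) * s := by
    intro v0 v1 c h1 h2 h3
    have h4 : (v1 * e0 - v0 * e1) ^ 2 < (E * s) ^ 2 := by
      rw [← sq_abs]
      exact pow_lt_pow_left₀ (h2.trans_lt h3) (abs_nonneg _) two_ne_zero
    have id : (v0 * e0 + v1 * e1) ^ 2 + (v1 * e0 - v0 * e1) ^ 2 = E ^ 2 * (v0 ^ 2 + v1 ^ 2) := by
      rw [hE]; ring
    have h5 : E ^ 2 * (v0 ^ 2 + v1 ^ 2) < E ^ 2 * (2 * s) ^ 2 := by nlinarith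
    have h6 := lt_of_mul_lt_mul_left h5 (by positivity)
    push_cast
    constructor
    · exact abs_lt_of_sq_lt_sq (by nlinarith [sq_nonneg v1]) (by positivity)
    · exact abs_lt_of_sq_lt_sq (by nlinarith [sq_nonneg v0]) (by positivity)
  have hmaps : ∀ l ∈ T, gridPair s a b l ∈
      gridBox 2 (gridIndex s (a l')) ×ˢ gridBox 2 (gridIndex s (b l')) := by
    intro l hl
    rcases eq_or_ne l l' with rfl | hne
    · have : ∀ c, c ∈ gridBox 2 c := fun c => by simp [gridBox]
      exact Finset.mem_product.2 ⟨this _, this _⟩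
    obtain ⟨A, B, AB⟩ := h.cross_bounds hρ ha hb hl₀ (hT hl) (hT hl') hne hlong he0 he1
    have hlt := ht l hl l' hl'
    set P := (a l 1 - a l' 1) * e0 - (a l 0 - a l' 0) * e1
    set Q := (b l 1 - b l' 1) * e0 - (b l 0 - b l' 0) * e1
    have hP : |P| ≤ |P + Q| := by
      refine sq_le_sq.1 ?_
      nlinarith [sq_nonneg Q]
    have hQ : |Q| ≤ |P + Q| := by
      refine sq_le_sq.1 ?_
      nlinarith [sq_nonneg P]
    obtain ⟨A0, A1⟩ := sub A hP hlt
    obtain ⟨B0, B1⟩ := sub B hQ hlt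
    exact Finset.mem_product.2 ⟨gridIndex_mem_gridBox hs A0 A1, gridIndex_mem_gridBox hs B0 B1⟩
  have := Finset.card_le_card_of_injOn _ hmaps hinj
  simpa [Finset.card_product, card_gridBox] using this

/-- By `cross_bounds` a link is located, up to boundedly many choices, by one real coordinate across
the common direction. This coordinate varies over a range of order `ρ`, which is cut into strips of
width `s`. -/
theorem NonInterfering.card_class_le [DecidableEq ι] (h : NonInterfering (20 * ρ) a b S)
    (hρ : 0 < ρ) (hs : 0 < s) (hsr : s ≤ 20 * ρ)
    (ha : ∀ l ∈ S, ∀ l' ∈ S, gridIndex ρ (a l) = gridIndex ρ (a l'))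
    (hb : ∀ l ∈ S, ∀ l' ∈ S, gridIndex ρ (b l) = gridIndex ρ (b l'))
    (hinj : Set.InjOn (gridPair s a b) S) :
    (S.card : ℝ) ≤ 100000 * (ρ / s) := by
  have hR : 1 / 20 ≤ ρ / s := by rw [le_div_iff₀ hs]; linarith
  rcases S.eq_empty_or_nonempty with rfl | ⟨l₀, hl₀⟩
  · simp; positivity
  -- A short link tolerates no other link in its class: the other transmitter would be within `2 * ρ
  -- + 10 * ρ < 20 * ρ` of its receiver.
  by_cases hshort : ∃ l ∈ S, dist (a l) (b l) < 10 * ρ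
  · obtain ⟨l, hl, hd⟩ := hshort
    have : S ⊆ {l} := by
      intro l' hl'
      rw [Finset.mem_singleton]
      by_contra hne
      have h1 := h.2 l' hl' l hl hne
      have h2 : dist (a l') (a l) ≤ 2 * ρ := by
        refine (abs_le_of_sq_le_sq' ?_ (by positivity)).2
        rw [dist_sq_plane]
        have u0 := abs_lt.1 (abs_sub_lt_of_gridIndex_eq hρ (ha _ hl' _ hl) 0)
        have u1 := abs_lt.1 (abs_sub_lt_of_gridIndex_eq hρ (ha _ hl' _ hl) 1)
        nlinarith
      linarith [dist_triangle (a l') (a l) (b l)]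
    have := Finset.card_le_card this
    rw [Finset.card_singleton] at this
    have : (S.card : ℝ) ≤ 1 := by exact_mod_cast this
    linarith
  push Not at hshort
  have hlong := hshort l₀ hl₀
  obtain ⟨e0, he0⟩ : ∃ e0, e0 = b l₀ 0 - a l₀ 0 := ⟨_, rfl⟩
  obtain ⟨e1, he1⟩ : ∃ e1, e1 = b l₀ 1 - a l₀ 1 := ⟨_, rfl⟩
  obtain ⟨E, hE0, hE⟩ : ∃ E : ℝ, 0 < E ∧ E ^ 2 = e0 ^ 2 + e1 ^ 2 := by
    refine ⟨dist (a l₀) (b l₀), by linarith, ?_⟩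
    rw [dist_sq_plane, he0, he1]; ring
  -- The sum of the cross offsets of both ends, in units of `s`. Since the two offsets between links
  -- have equal sign, the difference of `t` dominates each of them.
  set t : ι → ℝ := fun l =>
    ((a l 1 * e0 - a l 0 * e1) + (b l 1 * e0 - b l 0 * e1)) / (E * s) with htdef
  have hEs : 0 < E * s := by positivity
  have htsub : ∀ l l', t l - t l' = (((a l 1 - a l' 1) * e0 - (a l 0 - a l' 0) * e1) +
        ((b l 1 - b l' 1) * e0 - (b l 0 - b l' 0) * e1)) / (E * s) := fun l l' => by
    simp only [htdef]; rw [← sub_div]; congr 1; ring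
  -- Both ends move by less than `ρ` in each coordinate, so `t` varies by at most `4 * ρ / s`; the
  -- extra 1 makes the inequality strict.
  set D : ℕ := ⌈4 * (ρ / s)⌉₊ + 1 with hD
  have hDle : (D : ℝ) ≤ 4 * (ρ / s) + 2 := by
    have := Nat.ceil_lt_add_one (a := 4 * (ρ / s)) (by positivity)
    rw [hD]; push_cast; linarith
  have hmaps : ∀ l ∈ S, ⌊t l⌋ ∈ Finset.Icc (⌊t l₀⌋ - (D : ℤ)) (⌊t l₀⌋ + D) := by
    intro l hl
    refine floor_mem_Icc_of_abs_sub_lt ?_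
    rw [htsub, abs_div, abs_of_pos hEs, div_lt_iff₀ hEs]
    have hc : 4 * (ρ / s) < D := by
      have := Nat.le_ceil (4 * (ρ / s))
      rw [hD]; push_cast; linarith
    have hc' : 4 * (ρ / s) * (E * s) < D * (E * s) := by gcongr
    refine lt_of_le_of_lt ?_ hc'
    have e : 4 * (ρ / s) * (E * s) = 4 * ρ * E := by field_simp
    rw [e]
    refine abs_le_of_sq_le_sq ?_ (by positivity)
    have u0 := abs_lt.1 (abs_sub_lt_of_gridIndex_eq hρ (ha _ hl _ hl₀) 0)
    have u1 := abs_lt.1 (abs_sub_lt_of_gridIndex_eq hρ (ha _ hl _ hl₀) 1)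
    have v0 := abs_lt.1 (abs_sub_lt_of_gridIndex_eq hρ (hb _ hl _ hl₀) 0)
    have v1 := abs_lt.1 (abs_sub_lt_of_gridIndex_eq hρ (hb _ hl _ hl₀) 1)
    set p := (a l 0 - a l₀ 0) + (b l 0 - b l₀ 0) with hp
    set q := (a l 1 - a l₀ 1) + (b l 1 - b l₀ 1) with hq
    have e2 : ((a l 1 - a l₀ 1) * e0 - (a l 0 - a l₀ 0) * e1) +
        ((b l 1 - b l₀ 1) * e0 - (b l 0 - b l₀ 0) * e1) = q * e0 - p * e1 := by
      rw [hp, hq]; ring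
    rw [e2]
    have hp2 : p ^ 2 ≤ (2 * ρ) ^ 2 := sq_le_sq' (by linarith) (by linarith)
    have hq2 : q ^ 2 ≤ (2 * ρ) ^ 2 := sq_le_sq' (by linarith) (by linarith)
    have : (q * e0 - p * e1) ^ 2 ≤ (p ^ 2 + q ^ 2) * E ^ 2 := by
      have id : (p ^ 2 + q ^ 2) * E ^ 2 = (q * e0 - p * e1) ^ 2 + (q * e1 + p * e0) ^ 2 := by
        rw [hE]; ring
      rw [id]
      exact le_add_of_nonneg_right (sq_nonneg _)
    calc _ ≤ (p ^ 2 + q ^ 2) * E ^ 2 := this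
      _ ≤ (16 * ρ ^ 2) * E ^ 2 := by gcongr; linarith [sq_nonneg ρ]
      _ = _ := by ring
  have hfib := card_le_mul_card_of_fiber (fun l => ⌊t l⌋) hmaps (B := 625) (by
    intro c _
    have := h.card_strip_le hρ hs ha hb hl₀ hlong he0 he1 hE0 hE
      (T := S.filter fun l => ⌊t l⌋ = c) (Finset.filter_subset _ _)
      (hinj.mono (by exact_mod_cast Finset.filter_subset _ _)) (by
        intro l hl l' hl'
        have := Int.abs_sub_lt_one_of_floor_eq_floor
          ((Finset.mem_filter.1 hl).2.trans (Finset.mem_filter.1 hl').2.symm)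
        rwa [htsub, abs_div, abs_of_pos hEs, div_lt_one hEs] at this)
    exact_mod_cast this)
  refine hfib.trans ?_
  have : (Finset.Icc (⌊t l₀⌋ - (D : ℤ)) (⌊t l₀⌋ + D)).card = 2 * D + 1 := by
    rw [Int.card_Icc]; omega
  rw [this]
  push_cast
  linarith

/-- The number of pairs of squares of mesh `s` occupied by non-interfering links. -/
theorem NonInterfering.card_image_gridPair_le (h : NonInterfering r a b S)
    (hs : 0 < s) (hsr : s ≤ r) (hr2 : r ≤ 2) (hcell : ∀ l ∈ S, a l ∈ unitCell) :
    ((S.image (gridPair s a b)).card : ℝ) ≤ 10 ^ 11 / (r * s) := by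
  classical
  -- One representative link is kept for each occupied pair of squares.
  obtain ⟨S', hS', himg, hinj⟩ : ∃ S' ⊆ S, S'.image (gridPair s a b) = S.image (gridPair s a b) ∧
      Set.InjOn (gridPair s a b) S' := by
    obtain ⟨u, hu, hinj, himg⟩ := Finset.exists_subset_injOn_image_eq_of_surjOn S
      (S.image (gridPair s a b)) (f := gridPair s a b) (by
        rw [Finset.coe_image]; exact Set.surjOn_image _ _)
    exact ⟨u, by exact_mod_cast hu, himg, hinj⟩
  rw [← himg]
  have hr : 0 < r := hs.trans_le hsr
  set ρ := r / 20 with hρdef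
  have hρ : 0 < ρ := by positivity
  have hrρ : r = 20 * ρ := by rw [hρdef]; ring
  have h' : NonInterfering (20 * ρ) a b S' := hrρ ▸ h.mono hS'
  set q : ℤ := ⌊1 / ρ⌋ with hq
  have hmaps : ∀ l ∈ S', gridIndex ρ (a l) ∈ Finset.Icc 0 q ×ˢ Finset.Icc 0 q := by
    intro l hl
    have hc := hcell l (hS' hl)
    have hi : ∀ i : Fin 2, ⌊a l i / ρ⌋ ∈ Finset.Icc 0 q := fun i => Finset.mem_Icc.2
      ⟨Int.floor_nonneg.2 (div_nonneg (hc i).1 hρ.le),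
        Int.floor_le_floor (div_le_div_of_nonneg_right (hc i).2 hρ.le)⟩
    exact Finset.mem_product.2 ⟨hi 0, hi 1⟩
  -- A link is shorter than `20 * ρ`, so for a given transmitter square there are `1681 = 41 ^ 2`
  -- candidate receiver squares.
  have step := card_le_mul_card_of_fiber (fun l => gridIndex ρ (a l)) hmaps
    (B := 100000 * (ρ / s) * 1681) (by
      intro c _
      have hmaps2 : ∀ l ∈ S'.filter (fun l => gridIndex ρ (a l) = c),
          gridIndex ρ (b l) ∈ gridBox 20 c := by
        intro l hl
        have hl := Finset.mem_filter.1 hl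
        rw [← hl.2]
        have hd : ∀ i : Fin 2, |b l i - a l i| < (20 : ℕ) * ρ := fun i => by
          have h1 := abs_sub_le_dist (b l) (a l) i
          have h2 := h'.1 l hl.1
          rw [dist_comm] at h2
          push_cast
          linarith
        exact gridIndex_mem_gridBox hρ (hd 0) (hd 1)
      have := card_le_mul_card_of_fiber (fun l => gridIndex ρ (b l)) hmaps2
        (B := 100000 * (ρ / s)) (by
          intro c' _
          refine NonInterfering.card_class_le (h'.mono ?_) hρ hs (hrρ ▸ hsr) ?_ ?_
            (hinj.mono ?_)
          · exact (Finset.filter_subset _ _).trans (Finset.filter_subset _ _)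
          · intro l hl l' hl'
            simp only [Finset.mem_filter] at hl hl'
            exact hl.1.2.trans hl'.1.2.symm
          · intro l hl l' hl'
            simp only [Finset.mem_filter] at hl hl'
            exact hl.2.trans hl'.2.symm
          · exact_mod_cast (Finset.filter_subset _ _).trans (Finset.filter_subset _ _))
      rwa [card_gridBox] at this)
  have hq0 : 0 ≤ q := Int.floor_nonneg.2 (by positivity)
  have hcard : ((Finset.Icc 0 q ×ˢ Finset.Icc 0 q).card : ℝ) ≤ (22 / r) ^ 2 := by
    rw [Finset.card_product, Int.card_Icc, ← sq]
    push_cast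
    have h1 : (((q + 1 - 0).toNat : ℕ) : ℝ) = (q : ℝ) + 1 := by
      have : (((q + 1 - 0).toNat : ℕ) : ℤ) = q + 1 := by omega
      exact_mod_cast this
    rw [h1]
    have hqle : (q : ℝ) ≤ 20 / r := by
      refine (Int.floor_le _).trans (le_of_eq ?_)
      rw [hρdef]; field_simp
    have hone : 1 ≤ 2 / r := by rw [le_div_iff₀ hr]; linarith
    have : (0 : ℝ) ≤ q := by exact_mod_cast hq0
    have e : 22 / r = 20 / r + 2 / r := by ring
    rw [e]
    gcongr
  have hle : ((S'.image (gridPair s a b)).card : ℝ) ≤ S'.card := by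
    exact_mod_cast Finset.card_image_le
  calc _ ≤ (S'.card : ℝ) := hle
    _ ≤ 100000 * (ρ / s) * 1681 * (22 / r) ^ 2 := step.trans (by gcongr)
    _ = (100000 / 20 * 1681 * 22 ^ 2) / (r * s) := by rw [hρdef]; field_simp
    _ ≤ _ := by gcongr; norm_num

end Packing

/-! ### From active links to requests between grid squares. -/

section ActiveLinks

variable {n m : ℕ} {r s : ℝ} {x : Fin n → Plane} {w f : Fin n → Fin m}

theorem exists_links_card_eq_numActiveLinks (r : ℝ) (x : Fin n → Plane) (w f : Fin n → Fin m) :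
    ∃ S : Finset (Link n), (∀ l ∈ S, l ∈ potentialLinks r x w f) ∧
      NonInterfering r (fun l : Link n => x l.1) (fun l => x l.2) S ∧
      S.card = numActiveLinks r x w f := by
  classical
  obtain ⟨T, hT⟩ := ((conflictGraph r x).induce
    (potentialLinks r x w f)).exists_isNIndepSet_indepNum
  refine ⟨T.map (Function.Embedding.subtype _), ?_, ⟨?_, ?_⟩, ?_⟩
  · intro l hl
    obtain ⟨t, _, rfl⟩ := Finset.mem_map.1 hl
    exact t.2
  · intro l hl
    obtain ⟨t, _, rfl⟩ := Finset.mem_map.1 hl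
    exact t.2.2.1
  · intro l hl l' hl' hne
    obtain ⟨t, ht, rfl⟩ := Finset.mem_map.1 hl
    obtain ⟨t', ht', rfl⟩ := Finset.mem_map.1 hl'
    have h := hT.isIndepSet ht ht' fun h => hne (by rw [h])
    by_contra hle
    exact h ⟨hne, Or.inl (not_lt.1 hle)⟩
  · rw [Finset.card_map]
    exact hT.card_eq

theorem card_le_numActiveLinks {S : Finset (Link n)} (h1 : ∀ l ∈ S, l ∈ potentialLinks r x w f)
    (h2 : ∀ l ∈ S, ∀ l' ∈ S, l ≠ l' → r < dist (x l.1) (x l'.2)) :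
    S.card ≤ numActiveLinks r x w f := by
  classical
  let T : Finset (potentialLinks r x w f) := S.subtype (· ∈ potentialLinks r x w f)
  have hT : ((conflictGraph r x).induce (potentialLinks r x w f)).IsIndepSet (T : Set _) := by
    intro t ht t' ht' hne hadj
    have ht : (t : Link n) ∈ S := Finset.mem_subtype.1 ht
    have ht' : (t' : Link n) ∈ S := Finset.mem_subtype.1 ht'
    have hne : (t : Link n) ≠ t' := fun h => hne (Subtype.ext h)
    rcases hadj.2 with h | h
    · exact absurd h (not_le.2 (h2 _ ht _ ht' hne))
    · exact absurd h (not_le.2 (h2 _ ht' _ ht hne.symm))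
  have := hT.card_le_indepNum
  rw [Finset.card_subtype, Finset.filter_true_of_mem h1] at this
  exact this

/-- A common receiver would be both within `r` of its own transmitter and farther than `r` from it,
as the transmitter of the other link. -/
theorem NonInterfering.receiver_injOn {S : Finset (Link n)}
    (h : NonInterfering r (fun l : Link n => x l.1) (fun l => x l.2) S) :
    Set.InjOn (fun l : Link n => l.2) S := by
  intro l hl l' hl' he
  by_contra hne
  have h1 := h.2 l hl l' hl' hne
  have h2 := h.1 l hl
  simp only at he h1 h2
  rw [he] at h2
  exact lt_asymm h1 h2

theorem numActiveLinks_le (r : ℝ) (x : Fin n → Plane) (w f : Fin n → Fin m) :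
    numActiveLinks r x w f ≤ n := by
  obtain ⟨S, _, h, hc⟩ := exists_links_card_eq_numActiveLinks r x w f
  rw [← hc]
  simpa using Finset.card_le_card_of_injOn (t := Finset.univ) _ (fun _ _ => Finset.mem_univ _)
    h.receiver_injOn

/-- The users in the square `j` that request a file cached in the square `i`. -/
def gridHits (s : ℝ) (x : Fin n → Plane) (w f : Fin n → Fin m) (p : (ℤ × ℤ) × (ℤ × ℤ)) :
    Finset (Fin n) :=
  {v | gridIndex s (x v) = p.2 ∧ ∃ u, gridIndex s (x u) = p.1 ∧ w u = f v}

/-- Pairs of squares of the unit cell at distance at most `D`. -/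
def nearPairs (g D : ℕ) : Finset ((ℤ × ℤ) × (ℤ × ℤ)) :=
  (Finset.Icc (0 : ℤ) g ×ˢ Finset.Icc (0 : ℤ) g).biUnion fun i => (gridBox D i).image (Prod.mk i)

theorem card_nearPairs_le {g : ℕ} (hg : 1 ≤ g) (D : ℕ) :
    (nearPairs g D).card ≤ 4 * g ^ 2 * (2 * D + 1) ^ 2 := by
  refine Finset.card_biUnion_le.trans ?_
  refine (Finset.sum_le_card_nsmul _ _ ((2 * D + 1) ^ 2) fun i _ => ?_).trans ?_
  · exact Finset.card_image_le.trans (card_gridBox D i).le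
  · rw [Finset.card_product, Int.card_Icc, smul_eq_mul]
    have : ((g : ℤ) + 1 - 0).toNat = g + 1 := by omega
    rw [this]
    have : (g + 1) * (g + 1) ≤ 4 * g ^ 2 := by nlinarith
    gcongr

theorem gridPair_mem_nearPairs {g D : ℕ} (hg : 1 ≤ g) {y z : Plane} (hy : y ∈ unitCell)
    (h : dist y z < D * (1 / g : ℝ)) :
    (gridIndex (1 / g) y, gridIndex (1 / g) z) ∈ nearPairs g D := by
  have hg0 : (0 : ℝ) < g := by exact_mod_cast hg
  refine Finset.mem_biUnion.2 ⟨gridIndex (1 / g) y, ?_, Finset.mem_image.2 ⟨_, ?_, rfl⟩⟩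
  · have hi : ∀ i : Fin 2, ⌊y i / (1 / (g : ℝ))⌋ ∈ Finset.Icc (0 : ℤ) g := fun i => by
      rw [div_div_eq_mul_div, div_one, Finset.mem_Icc]
      refine ⟨Int.floor_nonneg.2 (mul_nonneg (hy i).1 hg0.le), ?_⟩
      have : y i * g ≤ ((g : ℤ) : ℝ) := by
        push_cast; exact mul_le_of_le_one_left hg0.le (hy i).2
      exact (Int.floor_le_floor this).trans (Int.floor_intCast _).le
    exact Finset.mem_product.2 ⟨hi 0, hi 1⟩
  · rw [dist_comm] at h
    exact gridIndex_mem_gridBox (by positivity) ((abs_sub_le_dist z y 0).trans_lt h)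
      ((abs_sub_le_dist z y 1).trans_lt h)

/-- Links over one pair of squares have distinct receivers, and each receiver is a hit for that
pair. -/
theorem NonInterfering.card_le_sum_gridHits {S : Finset (Link n)}
    (h : NonInterfering r (fun l : Link n => x l.1) (fun l => x l.2) S)
    (hS : ∀ l ∈ S, l ∈ potentialLinks r x w f) (s : ℝ) :
    S.card ≤ ∑ p ∈ S.image (gridPair s (fun l : Link n => x l.1) (fun l => x l.2)),
      (gridHits s x w f p).card := by
  classical
  rw [Finset.card_eq_sum_card_image (gridPair s (fun l : Link n => x l.1) (fun l => x l.2)) S]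
  refine Finset.sum_le_sum fun p _ => ?_
  refine Finset.card_le_card_of_injOn (fun l => l.2) ?_
    (h.receiver_injOn.mono (by exact_mod_cast Finset.filter_subset _ _))
  intro l hl
  have hl := Finset.mem_filter.1 hl
  rw [← hl.2]
  exact Finset.mem_filter.2 ⟨Finset.mem_univ _, rfl, l.1, rfl, (hS l hl.1).2.2.1⟩

/-- Deterministic bound for the number of active links by the numbers of requests that can be
served between squares of mesh `1 / g`. -/
theorem exists_numActiveLinks_le_sum_gridHits (r : ℝ) {g : ℕ} (hg : 1 ≤ g) :
    ∃ (K : ℝ) (N : Finset ((ℤ × ℤ) × (ℤ × ℤ))), 1 ≤ K ∧ (N.card : ℝ) ≤ 100 * g ^ 2 * K ^ 2 ∧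
      ∀ {n m : ℕ} (x : Fin n → Plane) (w f : Fin n → Fin m), (∀ u, x u ∈ unitCell) →
        (numActiveLinks r x w f : ℝ) ≤ 10 ^ 11 * g ^ 2 +
          ∑ p ∈ N, ((gridHits (1 / g) x w f p).card : ℝ) ^ 3 / K ^ 2 := by
  classical
  have hg1 : (1 : ℝ) ≤ g := by exact_mod_cast hg
  have hg0 : (0 : ℝ) < g := by linarith
  have main : ∀ {n m : ℕ} (x : Fin n → Plane) (w f : Fin n → Fin m), (∀ u, x u ∈ unitCell) →
      ∀ (K : ℝ) (D : ℕ), 1 ≤ K → r ≤ D * (1 / g : ℝ) → ∃ S : Finset (Link n),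
      NonInterfering r (fun l : Link n => x l.1) (fun l => x l.2) S ∧
      S.image (gridPair (1 / g) (fun l : Link n => x l.1) (fun l => x l.2)) ⊆ nearPairs g D ∧
      (numActiveLinks r x w f : ℝ) ≤
        K * (S.image (gridPair (1 / g) (fun l : Link n => x l.1) (fun l => x l.2))).card +
          ∑ p ∈ nearPairs g D, ((gridHits (1 / g) x w f p).card : ℝ) ^ 3 / K ^ 2 := by
    intro n m x w f hx K D hK hD
    obtain ⟨S, hS, hN, hc⟩ := exists_links_card_eq_numActiveLinks r x w f
    have hsub : S.image (gridPair (1 / g) (fun l : Link n => x l.1) (fun l => x l.2)) ⊆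
        nearPairs g D := by
      intro p hp
      obtain ⟨l, hl, rfl⟩ := Finset.mem_image.1 hp
      exact gridPair_mem_nearPairs hg (hx _) ((hN.1 l hl).trans_le hD)
    refine ⟨S, hN, hsub, ?_⟩
    rw [← hc]
    have h1 : (S.card : ℝ) ≤ ∑ p ∈ S.image (gridPair (1 / g) (fun l : Link n => x l.1)
        (fun l => x l.2)), ((gridHits (1 / g) x w f p).card : ℝ) := by
      exact_mod_cast hN.card_le_sum_gridHits hS (1 / g)
    refine h1.trans ?_
    -- The power 3 is chosen because the number of pairs in range grows like `K ^ 2`, which the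
    -- factor `1 / K ^ 2` compensates.
    have h2 : ∀ X : ℝ, 0 ≤ X → X ≤ K + X ^ 3 / K ^ 2 := by
      intro X hX
      rcases le_total X K with h | h
      · have : 0 ≤ X ^ 3 / K ^ 2 := by positivity
        linarith
      · have : X ≤ X ^ 3 / K ^ 2 := by
          rw [le_div_iff₀ (by positivity)]
          have : K ^ 2 ≤ X ^ 2 := by gcongr
          calc X * K ^ 2 ≤ X * X ^ 2 := by gcongr
            _ = _ := by ring
        linarith
    refine (Finset.sum_le_sum fun p _ => h2 _ (Nat.cast_nonneg _)).trans ?_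
    rw [Finset.sum_add_distrib, Finset.sum_const, nsmul_eq_mul, mul_comm]
    gcongr
  -- For a range below the mesh, only `O(g ^ 2)` pairs are in range and no packing is needed, so `K
  -- = 1`.
  rcases le_or_gt r (1 / g) with hr | hr
  · refine ⟨1, nearPairs g 1, le_rfl, ?_, fun x w f hx => ?_⟩
    · have : ((nearPairs g 1).card : ℝ) ≤ 4 * g ^ 2 * (2 * 1 + 1) ^ 2 := by
        exact_mod_cast card_nearPairs_le hg 1
      nlinarith
    · obtain ⟨S, _, hsub, hle⟩ := main x w f hx 1 1 le_rfl (by simpa using hr)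
      refine hle.trans (add_le_add ?_ le_rfl)
      have : ((S.image (gridPair (1 / g) (fun l : Link _ => x l.1) (fun l => x l.2))).card : ℝ) ≤
          4 * g ^ 2 * (2 * 1 + 1) ^ 2 := by
        exact_mod_cast (Finset.card_le_card hsub).trans (card_nearPairs_le hg 1)
      nlinarith
  rcases le_or_gt r 2 with hr2 | hr2
  · have hr0 : 0 < r := lt_trans (by positivity) hr
    have hK : 1 ≤ r * g := by
      rw [div_lt_iff₀ hg0] at hr; exact hr.le
    refine ⟨r * g, nearPairs g ⌈r * g⌉₊, hK, ?_, fun x w f hx => ?_⟩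
    · have h1 : ((nearPairs g ⌈r * g⌉₊).card : ℝ) ≤ 4 * g ^ 2 * (2 * (⌈r * g⌉₊ : ℝ) + 1) ^ 2 := by
        exact_mod_cast card_nearPairs_le hg _
      have h2 := Nat.ceil_lt_add_one (a := r * g) (by positivity)
      refine h1.trans ?_
      calc _ ≤ 4 * (g : ℝ) ^ 2 * (5 * (r * g)) ^ 2 := by gcongr; linarith
        _ = _ := by ring
    · obtain ⟨S, hN, _, hle⟩ := main x w f hx (r * g) ⌈r * g⌉₊ hK (by
        have := Nat.le_ceil (r * g)
        rw [mul_one_div, le_div_iff₀ hg0]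
        exact this)
      refine hle.trans (add_le_add ?_ le_rfl)
      have := hN.card_image_gridPair_le (s := 1 / g) (by positivity) hr.le hr2
        (fun l _ => hx l.1)
      calc _ ≤ r * g * (10 ^ 11 / (r * (1 / g))) :=
            mul_le_mul_of_nonneg_left this (by positivity)
        _ = _ := by field_simp
  -- For `r > 2` every transmitter reaches every receiver of the cell, so at most one link is
  -- active.
  · refine ⟨1, ∅, le_rfl, by simp, fun x w f hx => ?_⟩
    obtain ⟨S, hS, hN, hc⟩ := exists_links_card_eq_numActiveLinks r x w f
    have : S.card ≤ 1 := by
      refine Finset.card_le_one.2 fun l hl l' hl' => ?_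
      by_contra hne
      have h1 := hN.2 l hl l' hl' hne
      have h2 : dist (x l.1) (x l'.2) ≤ 2 := by
        refine (abs_le_of_sq_le_sq' ?_ (by norm_num)).2
        rw [dist_sq_plane]
        have u0 := hx l.1 0
        have u1 := hx l.1 1
        have v0 := hx l'.2 0
        have v1 := hx l'.2 1
        simp only [Set.mem_Icc] at u0 u1 v0 v1
        nlinarith
      linarith
    have : (numActiveLinks r x w f : ℝ) ≤ 1 := by rw [← hc]; exact_mod_cast this
    simp only [Finset.sum_empty, add_zero]
    nlinarith

end ActiveLinks

/-! ### Moments of binomial variables. -/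

section Moments

variable {Ω : Type*} [MeasurableSpace Ω] {ν : Measure Ω} [IsProbabilityMeasure ν]

/-- Exponential moment of a binomial variable. -/
theorem integral_exp_card_le {n : ℕ} {A : Set Ω} [DecidablePred (· ∈ A)] (hA : MeasurableSet A)
    (J : Finset (Fin n)) (c : ℝ) :
    ∫ y, Real.exp (c * ((J.filter fun v => y v ∈ A).card : ℝ)) ∂(Measure.pi fun _ : Fin n => ν) ≤
      Real.exp (J.card * ν.real A * (Real.exp c - 1)) := by
  classical
  have h1 : ∀ y : Fin n → Ω, Real.exp (c * ((J.filter fun v => y v ∈ A).card : ℝ)) =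
      ∏ v, (if v ∈ J then 1 + A.indicator (fun _ => Real.exp c - 1) (y v) else 1) := by
    intro y
    rw [← Finset.prod_filter, Finset.filter_mem_eq_inter, Finset.univ_inter, mul_comm,
      Real.exp_nat_mul, Finset.card_filter, ← Finset.prod_pow_eq_pow_sum]
    refine Finset.prod_congr rfl fun v _ => ?_
    by_cases h : y v ∈ A <;> simp [h]
  simp_rw [h1]
  rw [integral_fintype_prod_eq_prod
    (f := fun v y => if v ∈ J then 1 + A.indicator (fun _ => Real.exp c - 1) y else 1)]
  have h2 : ∀ v : Fin n,
      ∫ y, (if v ∈ J then 1 + A.indicator (fun _ => Real.exp c - 1) y else 1) ∂ν =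
        if v ∈ J then 1 + ν.real A * (Real.exp c - 1) else 1 := by
    intro v
    split_ifs with h
    · rw [integral_add (integrable_const _) ((integrable_const _).indicator hA),
        integral_indicator hA]
      simp
    · simp
  simp_rw [h2]
  rw [← Finset.prod_filter, Finset.filter_mem_eq_inter, Finset.univ_inter, Finset.prod_const,
    mul_assoc, Real.exp_nat_mul]
  have h0 : 0 ≤ 1 + ν.real A * (Real.exp c - 1) := by
    have : ν.real A ≤ 1 := measureReal_le_one
    have := Real.exp_pos c
    nlinarith [measureReal_nonneg (μ := ν) (s := A)]
  refine pow_le_pow_left₀ h0 ?_ _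
  linarith [Real.add_one_le_exp (ν.real A * (Real.exp c - 1))]

/-- Third moment of a binomial variable on a finite space. -/
theorem integral_card_pow_three_le {n m : ℕ} {ν : Measure (Fin m)} [IsProbabilityMeasure ν]
    (A : Set (Fin m)) [DecidablePred (· ∈ A)] (J : Finset (Fin n)) :
    ∫ y, ((J.filter fun v => y v ∈ A).card : ℝ) ^ 3 ∂(Measure.pi fun _ : Fin n => ν) ≤
      6 * Real.exp 2 * (1 + J.card * ν.real A) ^ 3 := by
  set μ : ℝ := J.card * ν.real A with hμ
  have hμ0 : 0 ≤ μ := by positivity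
  -- With this scale the exponential moment is bounded uniformly in `μ`, and `X ^ 3 ≤ 6 * c⁻¹ ^ 3 *
  -- exp (c * X)`.
  set c : ℝ := 1 / (1 + μ) with hc
  have hc0 : 0 < c := by positivity
  have hc1 : c ≤ 1 := by rw [hc, div_le_one (by positivity)]; linarith
  have h1 : ∀ y : Fin n → Fin m, ((J.filter fun v => y v ∈ A).card : ℝ) ^ 3 ≤
      6 * (1 + μ) ^ 3 * Real.exp (c * ((J.filter fun v => y v ∈ A).card : ℝ)) := by
    intro y
    set X : ℝ := ((J.filter fun v => y v ∈ A).card : ℝ) with hX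
    have hX0 : 0 ≤ X := by positivity
    have := Real.pow_div_factorial_le_exp (c * X) (by positivity) 3
    have e : X ^ 3 = 6 * (1 + μ) ^ 3 * ((c * X) ^ 3 / (Nat.factorial 3 : ℕ)) := by
      rw [hc]; norm_num [Nat.factorial]; field_simp
    calc X ^ 3 = 6 * (1 + μ) ^ 3 * ((c * X) ^ 3 / (Nat.factorial 3 : ℕ)) := e
      _ ≤ _ := by gcongr
  refine (integral_mono Integrable.of_finite Integrable.of_finite h1).trans ?_
  rw [integral_const_mul]
  have h2 := integral_exp_card_le (ν := ν) (A := A) A.toFinite.measurableSet J c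
  have h3 : Real.exp c - 1 ≤ 2 * c := by
    have := Real.abs_exp_sub_one_le (x := c) (by rwa [abs_of_pos hc0])
    rw [abs_of_pos hc0] at this
    exact (le_abs_self _).trans this
  have h4 : Real.exp (μ * (Real.exp c - 1)) ≤ Real.exp 2 := by
    refine Real.exp_le_exp.2 ?_
    have : μ * c ≤ 1 := by rw [hc, mul_one_div, div_le_one (by positivity)]; linarith
    nlinarith
  calc _ ≤ 6 * (1 + μ) ^ 3 * Real.exp 2 := by
        gcongr
        exact h2.trans h4
    _ = _ := by ring

end Moments

/-! ### Uniform positions in the unit cell. -/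

section Positions

theorem volume_plane_box (I J : Set ℝ) :
    volume {y : Plane | y 0 ∈ I ∧ y 1 ∈ J} = volume I * volume J := by
  have h : {y : Plane | y 0 ∈ I ∧ y 1 ∈ J} = (MeasurableEquiv.toLp 2 (Fin 2 → ℝ)).symm ⁻¹'
      (Set.univ.pi ![I, J]) := by
    ext y
    simp [Fin.forall_fin_two]
  rw [h, (EuclideanSpace.volume_preserving_symm_measurableEquiv_toLp (Fin 2)).measure_preimage_equiv,
    volume_pi_pi, Fin.prod_univ_two]
  rfl

theorem measurable_gridIndex (s : ℝ) : Measurable (gridIndex s) := by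
  unfold gridIndex
  refine Measurable.prodMk ?_ ?_
  · exact Int.measurable_floor.comp ((by fun_prop : Measurable fun y : Plane => y 0 / s))
  · exact Int.measurable_floor.comp ((by fun_prop : Measurable fun y : Plane => y 1 / s))

theorem positionLaw_gridIndex_le {s : ℝ} (hs : 0 < s) (i : ℤ × ℤ) :
    positionLaw.real (gridIndex s ⁻¹' {i}) ≤ s ^ 2 := by
  have h : gridIndex s ⁻¹' {i} ⊆ {y : Plane | y 0 ∈ Set.Ico (i.1 * s) ((i.1 + 1) * s) ∧
      y 1 ∈ Set.Ico (i.2 * s) ((i.2 + 1) * s)} := by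
    intro y hy
    have hy : gridIndex s y = i := hy
    rw [← hy]
    simp only [gridIndex, Set.mem_ofPred_eq, Set.mem_Ico, ← le_div_iff₀ hs, ← div_lt_iff₀ hs]
    exact ⟨⟨Int.floor_le _, Int.lt_floor_add_one _⟩, Int.floor_le _, Int.lt_floor_add_one _⟩
  rw [Measure.real]
  refine ENNReal.toReal_le_of_le_ofReal (by positivity) ?_
  refine (Measure.restrict_apply_le _ _).trans ((measure_mono h).trans ?_)
  rw [volume_plane_box, Real.volume_Ico, Real.volume_Ico, ← ENNReal.ofReal_mul (by nlinarith)]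
  refine ENNReal.ofReal_le_ofReal (le_of_eq ?_)
  ring

theorem ae_mem_unitCell (n : ℕ) :
    ∀ᵐ x ∂(Measure.pi fun _ : Fin n => positionLaw), ∀ u, x u ∈ unitCell := by
  rw [ae_all_iff]
  intro u
  have : ∀ᵐ y ∂positionLaw, y ∈ unitCell := by
    refine ae_restrict_mem ?_
    have : unitCell = ⋂ i : Fin 2, (fun y : Plane => y i) ⁻¹' Set.Icc 0 1 := by
      ext y; simp [unitCell]
    rw [this]
    exact MeasurableSet.iInter fun i => measurableSet_Icc.preimage (by fun_prop)
  exact (Measure.quasiMeasurePreserving_eval (fun _ : Fin n => positionLaw) u).ae this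

end Positions

/-! ### Upper bound for arbitrary policies. -/

section UpperBound

variable {n m : ℕ}

theorem integrable_numActiveLinks {γr r : ℝ} [NeZero m] (κ : CachingPolicy n m)
    [IsMarkovKernel κ] :
    Integrable (fun ω => (numActiveLinks r ω.1.1 ω.1.2 ω.2 : ℝ)) (networkLaw γr κ) := by
  unfold networkLaw
  refine Integrable.of_bound ?_ (n : ℝ) (ae_of_all _ fun ω => ?_)
  · exact (measurable_from_nat.comp (measurable_numActiveLinks r)).aestronglyMeasurable
  · rw [Real.norm_of_nonneg (Nat.cast_nonneg _)]
    exact_mod_cast numActiveLinks_le r _ _ _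

/-- A bound for the mean over the requests that depends on the positions only, integrated. -/
theorem expectedActiveLinks_le_integral {γr r : ℝ} [NeZero m] (κ : CachingPolicy n m)
    [IsMarkovKernel κ] {H : (Fin n → Plane) → ℝ}
    (hH : Integrable H (Measure.pi fun _ => positionLaw))
    (h : ∀ᵐ x ∂(Measure.pi fun _ : Fin n => positionLaw), ∀ w : Fin n → Fin m,
      ∫ f, (numActiveLinks r x w f : ℝ) ∂(Measure.pi fun _ => zipfLaw γr m) ≤ H x) :
    expectedActiveLinks γr r κ ≤ ∫ x, H x ∂(Measure.pi fun _ => positionLaw) := by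
  have hint := integrable_numActiveLinks (γr := γr) (r := r) κ
  unfold expectedActiveLinks
  unfold networkLaw at hint ⊢
  rw [integral_prod _ hint]
  set P : Measure (Fin n → Plane) := Measure.pi fun _ => positionLaw
  have hmp : MeasurePreserving Prod.fst (P ⊗ₘ κ) P :=
    ⟨measurable_fst, Measure.fst_compProd P κ⟩
  have e : ∫ z, H z.1 ∂(P ⊗ₘ κ) = ∫ x, H x ∂P := by
    rw [← hmp.map_eq, integral_map measurable_fst.aemeasurable (by rw [hmp.map_eq]; exact hH.1)]
    rw [hmp.map_eq]
  rw [← e]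
  refine integral_mono_ae hint.integral_prod_left (hmp.integrable_comp_of_integrable hH) ?_
  filter_upwards [hmp.quasiMeasurePreserving.ae h] with z hz
  exact hz z.2

/-- The users in a square. -/
def usersIn (s : ℝ) (x : Fin n → Plane) (i : ℤ × ℤ) : Finset (Fin n) :=
  {u | gridIndex s (x u) = i}

/-- With positions and caches fixed, the hits are binomial. Their parameter depends on the caches
only through the number of distinct files in the first square, at most its number of users. The
bound thus involves positions alone and holds for every policy. -/
theorem integral_gridHits_le {γ : ℝ} (h0 : 0 ≤ γ) (h1 : γ < 1) [NeZero m] (s : ℝ)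
    (x : Fin n → Plane) (w : Fin n → Fin m) (p : (ℤ × ℤ) × (ℤ × ℤ)) {N : ℝ} (hN : 1 ≤ N)
    (hNm : N * (N / m) ^ (1 - γ) ≤ 16) :
    ∫ f, ((gridHits s x w f p).card : ℝ) ^ 3 ∂(Measure.pi fun _ => zipfLaw γ m) ≤
      3 * Real.exp 2 * (32 / (1 - γ)) ^ 3 *
        (Real.exp (6 / N * (usersIn s x p.1).card) +
          Real.exp (6 / N * (usersIn s x p.2).card)) := by
  classical
  have hm : (0 : ℝ) < m := by exact_mod_cast NeZero.pos m
  have hγ : 0 < 1 - γ := by linarith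
  set W : Set (Fin m) := {k | ∃ u, gridIndex s (x u) = p.1 ∧ w u = k} with hW
  have e : ∀ f : Fin n → Fin m, gridHits s x w f p =
      (usersIn s x p.2).filter fun v => f v ∈ W := by
    intro f
    ext v
    simp [gridHits, usersIn, hW]
  simp_rw [e]
  refine (integral_card_pow_three_le W _).trans ?_
  set ni : ℝ := ((usersIn s x p.1).card : ℝ) with hni
  set nj : ℝ := ((usersIn s x p.2).card : ℝ) with hnj
  have hni0 : 0 ≤ ni := by positivity
  have hnj0 : 0 ≤ nj := by positivity
  set k : ℕ := ⌈N⌉₊ with hk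
  have hk1 : 1 ≤ k := Nat.one_le_ceil_iff.2 (by linarith)
  have hNk : N ≤ k := Nat.le_ceil N
  have hkN : (k : ℝ) ≤ 2 * N := by
    have := Nat.ceil_lt_add_one (a := N) (by linarith)
    linarith
  have hq : (zipfLaw γ m).real W ≤ 2 / (1 - γ) * (N / m) ^ (1 - γ) * (1 + ni / N) := by
    rw [Measure.real, zipfLaw_apply, ENNReal.toReal_ofReal
      (Finset.sum_nonneg fun i _ => zipf_nonneg γ m i)]
    refine (sum_zipf_le h0 h1 m hk1 _).trans ?_
    have hcard : ((Finset.univ.filter fun i => i ∈ W).card : ℝ) ≤ ni := by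
      have : (Finset.univ.filter fun i => i ∈ W) ⊆ (usersIn s x p.1).image w := by
        intro i hi
        obtain ⟨u, hu, rfl⟩ := (Finset.mem_filter.1 hi).2
        exact Finset.mem_image_of_mem _ (Finset.mem_filter.2 ⟨Finset.mem_univ _, hu⟩)
      rw [hni]
      exact Nat.cast_le.2 ((Finset.card_le_card this).trans Finset.card_image_le)
    have hpow : ((k : ℝ) / m) ^ (1 - γ) ≤ 2 * (N / m) ^ (1 - γ) := by
      calc ((k : ℝ) / m) ^ (1 - γ) ≤ (2 * (N / m)) ^ (1 - γ) := by
            refine Real.rpow_le_rpow (by positivity) ?_ hγ.le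
            rw [← mul_div_assoc]; gcongr
        _ = 2 ^ (1 - γ) * (N / m) ^ (1 - γ) := Real.mul_rpow (by norm_num) (by positivity)
        _ ≤ 2 ^ (1 : ℝ) * (N / m) ^ (1 - γ) := by
            gcongr
            · norm_num
            · linarith
        _ = _ := by rw [Real.rpow_one]
    calc _ ≤ 1 / (1 - γ) * (2 * (N / m) ^ (1 - γ)) * (1 + ni / N) := by
          gcongr
      _ = _ := by ring
  have hμ : 1 + nj * (zipfLaw γ m).real W ≤ 32 / (1 - γ) * Real.exp (ni / N + nj / N) := by
    have hC : 1 ≤ 32 / (1 - γ) := by rw [le_div_iff₀ hγ]; linarith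
    have hb : 0 ≤ nj / N := by positivity
    have ha : 0 ≤ ni / N := by positivity
    have h2 : nj * (zipfLaw γ m).real W ≤ 32 / (1 - γ) * (nj / N * (1 + ni / N)) := by
      calc nj * (zipfLaw γ m).real W
          ≤ nj * (2 / (1 - γ) * (N / m) ^ (1 - γ) * (1 + ni / N)) := by gcongr
        _ = 2 / (1 - γ) * (N * (N / m) ^ (1 - γ)) * (nj / N * (1 + ni / N)) := by
            field_simp
        _ ≤ 2 / (1 - γ) * 16 * (nj / N * (1 + ni / N)) := by gcongr
        _ = _ := by ring
    have h3 : (1 + ni / N) * (1 + nj / N) ≤ Real.exp (ni / N + nj / N) := by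
      rw [Real.exp_add]
      have e1 := Real.add_one_le_exp (ni / N)
      have e2 := Real.add_one_le_exp (nj / N)
      refine mul_le_mul (by linarith) (by linarith) (by positivity) (by positivity)
    have h4 : 32 / (1 - γ) * ((1 + ni / N) * (1 + nj / N)) ≤
      32 / (1 - γ) * Real.exp (ni / N + nj / N) := by gcongr
    nlinarith
  -- The arithmetic-geometric mean inequality separates the two squares, so their dependent
  -- occupation numbers need no joint moment.
  have hexp : Real.exp (ni / N + nj / N) ^ 3 ≤
      (Real.exp (6 / N * ni) + Real.exp (6 / N * nj)) / 2 := by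
    have e1 : Real.exp (6 / N * ni) = (Real.exp (ni / N) ^ 3) ^ 2 := by
      rw [← Real.exp_nat_mul, ← Real.exp_nat_mul]; congr 1; push_cast; ring
    have e2 : Real.exp (6 / N * nj) = (Real.exp (nj / N) ^ 3) ^ 2 := by
      rw [← Real.exp_nat_mul, ← Real.exp_nat_mul]; congr 1; push_cast; ring
    rw [e1, e2, Real.exp_add, mul_pow]
    nlinarith [sq_nonneg (Real.exp (ni / N) ^ 3 - Real.exp (nj / N) ^ 3)]
  have h0' : 0 ≤ nj * (zipfLaw γ m).real W := by positivity
  calc _ ≤ 6 * Real.exp 2 * (32 / (1 - γ) * Real.exp (ni / N + nj / N)) ^ 3 := by gcongr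
    _ = 6 * Real.exp 2 * (32 / (1 - γ)) ^ 3 * Real.exp (ni / N + nj / N) ^ 3 := by ring
    _ ≤ 6 * Real.exp 2 * (32 / (1 - γ)) ^ 3 *
        ((Real.exp (6 / N * ni) + Real.exp (6 / N * nj)) / 2) := by gcongr
    _ = _ := by ring

theorem integrable_exp_usersIn (s c : ℝ) (i : ℤ × ℤ) :
    Integrable (fun x : Fin n → Plane => Real.exp (c * (usersIn s x i).card))
      (Measure.pi fun _ => positionLaw) := by
  refine Integrable.of_bound ?_ (Real.exp (|c| * n)) (ae_of_all _ fun x => ?_)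
  · have h : Measurable fun x : Fin n → Plane => ((usersIn s x i).card : ℝ) := by
      simp only [usersIn, Finset.card_filter, Nat.cast_sum]
      refine Finset.measurable_sum _ fun u _ => ?_
      refine measurable_from_nat.comp (Measurable.ite ?_ measurable_const measurable_const)
      exact (measurable_gridIndex s (measurableSet_singleton i)).preimage (measurable_pi_apply u)
    exact (Real.measurable_exp.comp (h.const_mul c)).aestronglyMeasurable
  · rw [Real.norm_of_nonneg (Real.exp_pos _).le, Real.exp_le_exp]
    have : ((usersIn s x i).card : ℝ) ≤ n := by
      exact_mod_cast (Finset.card_le_univ _).trans (Fintype.card_fin n).le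
    calc c * ((usersIn s x i).card : ℝ) ≤ |c| * ((usersIn s x i).card : ℝ) := by
          gcongr; exact le_abs_self c
      _ ≤ |c| * n := by gcongr

/-- The occupation number is binomial with mean at most `N`. At scale `6 / N ≤ 1` its exponential
moment is at most `exp (N * 2 * (6 / N))`. -/
theorem integral_exp_usersIn_le {s N : ℝ} (hs : 0 < s) (hN : 6 ≤ N) (hns : n * s ^ 2 ≤ N)
    (i : ℤ × ℤ) :
    ∫ x : Fin n → Plane, Real.exp (6 / N * (usersIn s x i).card)
      ∂(Measure.pi fun _ => positionLaw) ≤ Real.exp 12 := by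
  classical
  have h := integral_exp_card_le (ν := positionLaw) (A := gridIndex s ⁻¹' {i})
    (measurable_gridIndex s (measurableSet_singleton i)) (Finset.univ : Finset (Fin n)) (6 / N)
  have e : ∀ x : Fin n → Plane, usersIn s x i =
      Finset.univ.filter fun v => x v ∈ gridIndex s ⁻¹' {i} := fun x => by
    ext; simp [usersIn]
  simp_rw [e]
  refine h.trans (Real.exp_le_exp.2 ?_)
  have h6 : 0 < 6 / N := by positivity
  have h6' : 6 / N ≤ 1 := by rw [div_le_one (by linarith)]; exact hN
  have h3 : Real.exp (6 / N) - 1 ≤ 2 * (6 / N) := by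
    have := Real.abs_exp_sub_one_le (x := 6 / N) (by rwa [abs_of_pos h6])
    rw [abs_of_pos h6] at this
    exact (le_abs_self _).trans this
  have h4 : 0 ≤ Real.exp (6 / N) - 1 := by linarith [Real.add_one_le_exp (6 / N)]
  rw [Finset.card_univ, Fintype.card_fin]
  calc (n : ℝ) * positionLaw.real (gridIndex s ⁻¹' {i}) * (Real.exp (6 / N) - 1)
      ≤ n * s ^ 2 * (2 * (6 / N)) := by
        gcongr
        exact positionLaw_gridIndex_le hs i
    _ ≤ N * (2 * (6 / N)) := by gcongr
    _ = 12 := by field_simp; norm_num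

/-- Upper bound for arbitrary policies in terms of a grid whose squares contain about `N` users. -/
theorem expectedActiveLinks_le_grid {γr : ℝ} (h0 : 0 ≤ γr) (h1 : γr < 1) [NeZero m] (r : ℝ)
    (κ : CachingPolicy n m) [IsMarkovKernel κ] {g : ℕ} (hg : 1 ≤ g) {N : ℝ} (hN : 6 ≤ N)
    (hns : n * (1 / g : ℝ) ^ 2 ≤ N) (hNm : N * (N / m) ^ (1 - γr) ≤ 16) :
    expectedActiveLinks γr r κ ≤
      (10 ^ 11 + 600 * Real.exp 2 * (32 / (1 - γr)) ^ 3 * Real.exp 12) * g ^ 2 := by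
  obtain ⟨K, S, hK, hS, hle⟩ := exists_numActiveLinks_le_sum_gridHits r hg
  have hg0 : (0 : ℝ) < g := by exact_mod_cast hg
  have hγ : 0 < 1 - γr := by linarith
  set C : ℝ := 3 * Real.exp 2 * (32 / (1 - γr)) ^ 3 with hC
  set H : (Fin n → Plane) → ℝ := fun x => 10 ^ 11 * g ^ 2 + ∑ p ∈ S,
    C * (Real.exp (6 / N * (usersIn (1 / g) x p.1).card) +
          Real.exp (6 / N * (usersIn (1 / g) x p.2).card)) / K ^ 2 with hH
  have hint : ∀ p ∈ S, Integrable (fun x : Fin n → Plane =>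
      C * (Real.exp (6 / N * (usersIn (1 / g) x p.1).card) +
          Real.exp (6 / N * (usersIn (1 / g) x p.2).card)) / K ^ 2)
      (Measure.pi fun _ => positionLaw) := fun p _ =>
    (((integrable_exp_usersIn _ _ _).add (integrable_exp_usersIn _ _ _)).const_mul C).div_const _
  have hHint : Integrable H (Measure.pi fun _ => positionLaw) :=
    (integrable_const _).add (integrable_finsetSum _ hint)
  refine (expectedActiveLinks_le_integral κ hHint ?_).trans ?_
  · filter_upwards [ae_mem_unitCell n] with x hx w
    refine (integral_mono Integrable.of_finite Integrable.of_finite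
      (fun f => hle x w f hx)).trans ?_
    rw [integral_add Integrable.of_finite Integrable.of_finite, integral_const,
      integral_finsetSum _ fun p _ => Integrable.of_finite]
    simp only [probReal_univ, one_smul, hH]
    gcongr with p hp
    rw [integral_div]
    gcongr
    exact integral_gridHits_le h0 h1 _ x w p (by linarith) hNm
  · simp only [hH]
    rw [integral_add (integrable_const _) (integrable_finsetSum _ hint), integral_const,
      integral_finsetSum _ hint]
    simp only [probReal_univ, one_smul]
    have hb : ∀ p ∈ S, ∫ x : Fin n → Plane,
        C * (Real.exp (6 / N * (usersIn (1 / g) x p.1).card) +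
          Real.exp (6 / N * (usersIn (1 / g) x p.2).card)) / K ^ 2
        ∂(Measure.pi fun _ => positionLaw) ≤ C * (Real.exp 12 + Real.exp 12) / K ^ 2 := by
      intro p _
      rw [integral_div, integral_const_mul,
        integral_add (integrable_exp_usersIn _ _ _) (integrable_exp_usersIn _ _ _)]
      gcongr
      · exact integral_exp_usersIn_le (by positivity) hN hns _
      · exact integral_exp_usersIn_le (by positivity) hN hns _
    refine (add_le_add le_rfl (Finset.sum_le_sum hb)).trans ?_
    rw [Finset.sum_const, nsmul_eq_mul]
    have : (S.card : ℝ) * (C * (Real.exp 12 + Real.exp 12) / K ^ 2) ≤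
        100 * g ^ 2 * K ^ 2 * (C * (Real.exp 12 + Real.exp 12) / K ^ 2) := by gcongr
    refine (add_le_add le_rfl this).trans (le_of_eq ?_)
    rw [hC]; field_simp; ring

/-- The upper bound, for every collaboration distance and every policy. -/
theorem exists_forall_expectedActiveLinks_le {γr : ℝ} (h0 : 0 ≤ γr) (h1 : γr < 1)
    {m : ℕ → ℕ} (hm : Tendsto m atTop atTop)
    (hsub : (fun n : ℕ => (m n : ℝ)) =o[atTop] fun n : ℕ => (n : ℝ))
    {η : ℝ} (hη : η = (1 - γr) / (2 - γr)) :
    ∃ C : ℝ, 0 < C ∧ ∀ᶠ n : ℕ in atTop, ∀ (r : ℝ) (κ : CachingPolicy n (m n)), IsMarkovKernel κ →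
      expectedActiveLinks γr r κ ≤ C * ((n : ℝ) / (m n : ℝ) ^ η) := by
  have hγ : 0 < 1 - γr := by linarith
  refine ⟨10 ^ 11 + 600 * Real.exp 2 * (32 / (1 - γr)) ^ 3 * Real.exp 12, by positivity, ?_⟩
  have hη0 : 0 < η := by rw [hη]; exact div_pos hγ (by linarith)
  have hη1 : η ≤ 1 := by rw [hη, div_le_one (by linarith)]; linarith
  have hmR : Tendsto (fun n => (m n : ℝ)) atTop atTop := tendsto_natCast_atTop_atTop.comp hm
  have hmη := (tendsto_rpow_atTop hη0).comp hmR
  filter_upwards [hmη.eventually_ge_atTop 6, hm.eventually_ge_atTop 1,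
    hsub.bound one_pos] with n h6 hm1 hmn r κ hκ
  simp only [Function.comp] at h6
  rw [Real.norm_of_nonneg (Nat.cast_nonneg _), Real.norm_of_nonneg (Nat.cast_nonneg _),
    one_mul] at hmn
  have : NeZero (m n) := ⟨by omega⟩
  have hmp : (0 : ℝ) < m n := by exact_mod_cast hm1
  have hm1' : (1 : ℝ) ≤ m n := by exact_mod_cast hm1
  set M : ℝ := (m n : ℝ) ^ η with hM
  have hMn : M ≤ n := by
    refine le_trans ?_ hmn
    calc M ≤ (m n : ℝ) ^ (1 : ℝ) := Real.rpow_le_rpow_of_exponent_le hm1' hη1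
      _ = _ := Real.rpow_one _
  have hM0 : 0 < M := by positivity
  have hnM : 1 ≤ (n : ℝ) / M := (one_le_div hM0).2 hMn
  -- Rounding down loses at most a factor 4 in `g ^ 2`, since the root is at least 1; the grid bound
  -- is therefore applied with `N = 4 * M`.
  set g : ℕ := ⌊√((n : ℝ) / M)⌋₊ with hg
  have hsq1 : 1 ≤ √((n : ℝ) / M) := Real.one_le_sqrt.2 hnM
  have hg1 : 1 ≤ g := Nat.one_le_floor_iff _ |>.2 hsq1
  have hg1' : (1 : ℝ) ≤ g := by exact_mod_cast hg1
  have hgle : (g : ℝ) ^ 2 ≤ n / M := by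
    have := Nat.floor_le (Real.sqrt_nonneg ((n : ℝ) / M))
    calc (g : ℝ) ^ 2 ≤ √((n : ℝ) / M) ^ 2 := by gcongr
      _ = _ := Real.sq_sqrt (by positivity)
  have hgge : (n : ℝ) / M ≤ 4 * g ^ 2 := by
    have := Nat.lt_floor_add_one √((n : ℝ) / M)
    calc (n : ℝ) / M = √((n : ℝ) / M) ^ 2 := (Real.sq_sqrt (by positivity)).symm
      _ ≤ (2 * (g : ℝ)) ^ 2 := by gcongr; linarith
      _ = _ := by ring
  have hns : n * (1 / g : ℝ) ^ 2 ≤ 4 * M := by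
    rw [one_div, inv_pow, ← div_eq_mul_inv, div_le_iff₀ (by positivity)]
    rw [div_le_iff₀ hM0] at hgge
    linarith
  have hNm : 4 * M * (4 * M / m n) ^ (1 - γr) ≤ 16 := by
    -- The balance that determines `η`.
    have e1 : M * (M / m n) ^ (1 - γr) = 1 := by
      rw [hM, ← Real.rpow_sub_one hmp.ne', ← Real.rpow_mul hmp.le, ← Real.rpow_add hmp]
      have : η + (η - 1) * (1 - γr) = 0 := by
        rw [hη]; field_simp [(by linarith : (2 - γr) ≠ 0)]; ring
      rw [this, Real.rpow_zero]
    rw [mul_div_assoc, Real.mul_rpow (by norm_num) (by positivity)]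
    have e2 : (4 : ℝ) ^ (1 - γr) ≤ 4 := by
      calc (4 : ℝ) ^ (1 - γr) ≤ 4 ^ (1 : ℝ) :=
            Real.rpow_le_rpow_of_exponent_le (by norm_num) (by linarith)
        _ = 4 := Real.rpow_one _
    calc _ = 4 * (4 : ℝ) ^ (1 - γr) * (M * (M / m n) ^ (1 - γr)) := by ring
      _ ≤ 4 * 4 * 1 := by rw [e1]; gcongr
      _ = 16 := by norm_num
  refine (expectedActiveLinks_le_grid h0 h1 r κ hg1 (by linarith) hns hNm).trans ?_
  gcongr

end UpperBound

/-! ### First moment upper bound for Zipf caching. -/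

section ZipfCachingUpper

variable {n m : ℕ} {γr γc r : ℝ}

theorem networkLaw_zipfCaching [NeZero m] :
    networkLaw γr (zipfCaching n m γc) =
      ((Measure.pi fun _ => positionLaw).prod (Measure.pi fun _ => zipfLaw γc m)).prod
        (Measure.pi fun _ => zipfLaw γr m) := by
  unfold networkLaw zipfCaching
  rw [Measure.compProd_const]

theorem pi_zipfLaw_real_eval (γ : ℝ) [NeZero m] (u : Fin n) (A : Finset (Fin m)) :
    (Measure.pi fun _ : Fin n => zipfLaw γ m).real {f | f u ∈ A} = ∑ i ∈ A, zipf γ m i := by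
  classical
  have h := (measurePreserving_eval (fun _ : Fin n => zipfLaw γ m) u).measure_preimage
    (s := (A : Set (Fin m))) A.measurableSet.nullMeasurableSet
  have e : {f : Fin n → Fin m | f u ∈ A} = Function.eval u ⁻¹' (A : Set (Fin m)) := rfl
  rw [Measure.real, e, h, zipfLaw_apply,
    ENNReal.toReal_ofReal (Finset.sum_nonneg fun i _ => zipf_nonneg γ m i)]
  congr 1
  ext i
  simp

theorem pi_positionLaw_real_dist_lt_le (hr : 0 ≤ r) {u v : Fin n} (huv : u ≠ v) :
    (Measure.pi fun _ : Fin n => positionLaw).real {x | dist (x u) (x v) < r} ≤ 4 * r ^ 2 := by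
  set P : Measure (Fin n → Plane) := Measure.pi fun _ => positionLaw
  have hind : IndepFun (fun x : Fin n → Plane => x u) (fun x => x v) P :=
    (iIndepFun_pi (μ := fun _ : Fin n => positionLaw) (X := fun _ y => y)
      fun _ => aemeasurable_id).indepFun huv
  have hu : P.map (fun x => x u) = positionLaw :=
    (measurePreserving_eval (fun _ : Fin n => positionLaw) u).map_eq
  have hv : P.map (fun x => x v) = positionLaw :=
    (measurePreserving_eval (fun _ : Fin n => positionLaw) v).map_eq
  have hmap := (indepFun_iff_map_prod_eq_prod_map_map (measurable_pi_apply u).aemeasurable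
    (measurable_pi_apply v).aemeasurable).1 hind
  rw [hu, hv] at hmap
  have hS : MeasurableSet {q : Plane × Plane | dist q.1 q.2 < r} :=
    measurableSet_lt (measurable_fst.dist measurable_snd) measurable_const
  have e : P {x | dist (x u) (x v) < r} =
      (positionLaw.prod positionLaw) {q | dist q.1 q.2 < r} := by
    rw [← hmap, Measure.map_apply ((measurable_pi_apply u).prodMk (measurable_pi_apply v)) hS]
    rfl
  rw [Measure.real, e]
  refine ENNReal.toReal_le_of_le_ofReal (by positivity) ?_
  rw [Measure.prod_apply hS]
  have hb : ∀ y : Plane, positionLaw (Prod.mk y ⁻¹' {q : Plane × Plane | dist q.1 q.2 < r}) ≤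
      ENNReal.ofReal (4 * r ^ 2) := by
    intro y
    have hsub : Prod.mk y ⁻¹' {q : Plane × Plane | dist q.1 q.2 < r} ⊆
        {z : Plane | z 0 ∈ Set.Icc (y 0 - r) (y 0 + r) ∧ z 1 ∈ Set.Icc (y 1 - r) (y 1 + r)} := by
      intro z hz
      have hz : dist y z < r := hz
      have h0 := abs_le.1 ((abs_sub_le_dist y z 0).trans hz.le)
      have h1 := abs_le.1 ((abs_sub_le_dist y z 1).trans hz.le)
      exact ⟨⟨by linarith, by linarith⟩, by linarith, by linarith⟩
    refine (Measure.restrict_apply_le _ _).trans ((measure_mono hsub).trans ?_)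
    rw [volume_plane_box, Real.volume_Icc, Real.volume_Icc, ← ENNReal.ofReal_mul (by linarith)]
    exact ENNReal.ofReal_le_ofReal (le_of_eq (by ring))
  refine (lintegral_mono hb).trans ?_
  simp

/-- Interference enters only through the distinctness of receivers; for Zipf caching at this range
nothing more is lost in order. -/
theorem numActiveLinks_le_card (r : ℝ) (x : Fin n → Plane) (w f : Fin n → Fin m) :
    numActiveLinks r x w f ≤
      (Finset.univ.filter fun v => ∃ u, u ≠ v ∧ dist (x u) (x v) < r ∧ w u = f v).card := by
  classical
  obtain ⟨S, hS, h, hc⟩ := exists_links_card_eq_numActiveLinks r x w f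
  rw [← hc]
  refine Finset.card_le_card_of_injOn _ (fun l hl => ?_) h.receiver_injOn
  have := hS l hl
  exact Finset.mem_filter.2 ⟨Finset.mem_univ _, l.1, this.1, this.2.1, this.2.2.1⟩

/-- First moment bound: a request is served if it is for a popular file or for a file
cached by a user in range. -/
theorem expectedActiveLinks_zipfCaching_le_sum [NeZero m] (hr : 0 ≤ r) (k : ℕ) :
    expectedActiveLinks γr r (zipfCaching n m γc) ≤
      n * (∑ i : Fin m with i.val < k, zipf γr m i +
        n * (4 * r ^ 2 * ∑ i : Fin m with k ≤ i.val, zipf γc m i * zipf γr m i)) := by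
  classical
  set μ := networkLaw γr (zipfCaching n m γc) with hμ
  have hprob : IsProbabilityMeasure μ := by rw [hμ]; unfold networkLaw; infer_instance
  let A : Fin n → Set (((Fin n → Plane) × (Fin n → Fin m)) × (Fin n → Fin m)) := fun v =>
    {ω | ω.2 v ∈ Finset.univ.filter fun i : Fin m => i.val < k}
  let B : Fin n → Fin n → Fin m →
      Set (((Fin n → Plane) × (Fin n → Fin m)) × (Fin n → Fin m)) := fun u v i =>
    ({x | dist (x u) (x v) < r} ×ˢ {w | w u ∈ ({i} : Finset (Fin m))}) ×ˢ
      {f | f v ∈ ({i} : Finset (Fin m))}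
  have hAm : ∀ v, MeasurableSet (A v) := fun v =>
    (Set.toFinite {f : Fin n → Fin m | f v ∈ _}).measurableSet.preimage measurable_snd
  have hBm : ∀ u v i, MeasurableSet (B u v i) := fun u v i =>
    ((measurableSet_lt ((measurable_pi_apply u).dist (measurable_pi_apply v))
      measurable_const).prod (Set.toFinite _).measurableSet).prod (Set.toFinite _).measurableSet
  have hA : ∀ v, μ.real (A v) = ∑ i : Fin m with i.val < k, zipf γr m i := by
    intro v
    rw [← pi_zipfLaw_real_eval γr v, hμ, networkLaw_zipfCaching, Measure.real, Measure.real]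
    have : A v = Set.univ ×ˢ {f : Fin n → Fin m |
        f v ∈ Finset.univ.filter fun i : Fin m => i.val < k} := by
      ext ω; simp [A]
    rw [this, Measure.prod_prod, measure_univ, one_mul]
  have hB : ∀ u v i, u ≠ v → μ.real (B u v i) ≤ 4 * r ^ 2 * (zipf γc m i * zipf γr m i) := by
    intro u v i huv
    have h1 := pi_zipfLaw_real_eval (n := n) γc u ({i} : Finset (Fin m))
    have h2 := pi_zipfLaw_real_eval (n := n) γr v ({i} : Finset (Fin m))
    rw [Finset.sum_singleton] at h1 h2
    rw [hμ, networkLaw_zipfCaching]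
    simp only [B]
    rw [measureReal_prod_prod, measureReal_prod_prod, h1, h2, mul_assoc]
    exact mul_le_mul_of_nonneg_right (pi_positionLaw_real_dist_lt_le hr huv)
      (mul_nonneg (zipf_nonneg _ _ _) (zipf_nonneg _ _ _))
  have hle : ∀ ω, (numActiveLinks r ω.1.1 ω.1.2 ω.2 : ℝ) ≤
      ∑ v, ((A v).indicator (fun _ => (1 : ℝ)) ω + ∑ u with u ≠ v,
        ∑ i : Fin m with k ≤ i.val, (B u v i).indicator (fun _ => (1 : ℝ)) ω) := by
    intro ω
    have h1 : (numActiveLinks r ω.1.1 ω.1.2 ω.2 : ℝ) ≤ _ :=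
      Nat.cast_le.2 (numActiveLinks_le_card r ω.1.1 ω.1.2 ω.2)
    refine h1.trans ?_
    rw [Finset.card_filter, Nat.cast_sum]
    refine Finset.sum_le_sum fun v _ => ?_
    have hI : ∀ (s : Set (((Fin n → Plane) × (Fin n → Fin m)) × (Fin n → Fin m))),
        0 ≤ s.indicator (fun _ => (1 : ℝ)) ω := fun s =>
      Set.indicator_nonneg (fun _ _ => zero_le_one) _
    split_ifs with hv
    · obtain ⟨u, huv, hd, hw⟩ := hv
      push_cast
      by_cases hk : ((ω.2 v : Fin m) : ℕ) < k
      · have : (A v).indicator (fun _ => (1 : ℝ)) ω = 1 :=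
          Set.indicator_of_mem (by simp [A, hk]) _
        rw [this]
        have : 0 ≤ ∑ u with u ≠ v, ∑ i : Fin m with k ≤ i.val,
            (B u v i).indicator (fun _ => (1 : ℝ)) ω :=
          Finset.sum_nonneg fun _ _ => Finset.sum_nonneg fun _ _ => hI _
        linarith
      · have hB1 : (B u v (ω.2 v)).indicator (fun _ => (1 : ℝ)) ω = 1 :=
          Set.indicator_of_mem (by simp [B, hd, hw]) _
        have s1 : (B u v (ω.2 v)).indicator (fun _ => (1 : ℝ)) ω ≤
            ∑ i : Fin m with k ≤ i.val, (B u v i).indicator (fun _ => (1 : ℝ)) ω :=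
          Finset.single_le_sum (f := fun i => (B u v i).indicator (fun _ => (1 : ℝ)) ω)
            (fun _ _ => hI _) (Finset.mem_filter.2 ⟨Finset.mem_univ _, not_lt.1 hk⟩)
        have s2 := Finset.single_le_sum (f := fun u => ∑ i : Fin m with k ≤ i.val,
            (B u v i).indicator (fun _ => (1 : ℝ)) ω)
            (fun _ _ => Finset.sum_nonneg fun _ _ => hI _)
            (s := Finset.univ.filter fun u => u ≠ v) (Finset.mem_filter.2 ⟨Finset.mem_univ u, huv⟩)
        linarith [hI (A v)]
    · push_cast
      exact add_nonneg (hI _) (Finset.sum_nonneg fun _ _ => Finset.sum_nonneg fun _ _ => hI _)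
  have hIi : ∀ {s : Set (((Fin n → Plane) × (Fin n → Fin m)) × (Fin n → Fin m))},
      MeasurableSet s → Integrable (s.indicator fun _ => (1 : ℝ)) μ := fun hs =>
    (integrable_const _).indicator hs
  have hIv : ∀ {s : Set (((Fin n → Plane) × (Fin n → Fin m)) × (Fin n → Fin m))},
      MeasurableSet s → ∫ ω, s.indicator (fun _ => (1 : ℝ)) ω ∂μ = μ.real s := fun hs => by
    rw [integral_indicator hs]; simp
  have i1 : ∀ v u, Integrable (fun ω => ∑ i : Fin m with k ≤ i.val,
      (B u v i).indicator (fun _ => (1 : ℝ)) ω) μ := fun v u =>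
    integrable_finsetSum _ fun i _ => hIi (hBm u v i)
  have i2 : ∀ v, Integrable (fun ω => ∑ u with u ≠ v, ∑ i : Fin m with k ≤ i.val,
      (B u v i).indicator (fun _ => (1 : ℝ)) ω) μ := fun v =>
    integrable_finsetSum _ fun u _ => i1 v u
  rw [expectedActiveLinks, ← hμ]
  refine (integral_mono (integrable_numActiveLinks _)
    (integrable_finsetSum _ fun v _ => (hIi (hAm v)).add (i2 v)) hle).trans ?_
  rw [integral_finsetSum _ fun v _ => (hIi (hAm v)).add (i2 v)]
  have hv : ∀ v : Fin n, ∫ ω, ((A v).indicator (fun _ => (1 : ℝ)) ω + ∑ u with u ≠ v,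
        ∑ i : Fin m with k ≤ i.val, (B u v i).indicator (fun _ => (1 : ℝ)) ω) ∂μ ≤
      ∑ i : Fin m with i.val < k, zipf γr m i +
        n * (4 * r ^ 2 * ∑ i : Fin m with k ≤ i.val, zipf γc m i * zipf γr m i) := by
    intro v
    rw [integral_add (hIi (hAm v)) (i2 v), hIv (hAm v), hA,
      integral_finsetSum _ fun u _ => i1 v u]
    refine add_le_add le_rfl ?_
    have hu : ∀ u ∈ Finset.univ.filter fun u => u ≠ v,
        ∫ ω, ∑ i : Fin m with k ≤ i.val, (B u v i).indicator (fun _ => (1 : ℝ)) ω ∂μ ≤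
        4 * r ^ 2 * ∑ i : Fin m with k ≤ i.val, zipf γc m i * zipf γr m i := by
      intro u hu
      rw [integral_finsetSum _ fun i _ => hIi (hBm u v i), Finset.mul_sum]
      refine Finset.sum_le_sum fun i _ => ?_
      rw [hIv (hBm u v i)]
      exact hB u v i (Finset.mem_filter.1 hu).2
    refine (Finset.sum_le_card_nsmul _ _ _ hu).trans ?_
    rw [nsmul_eq_mul]
    have h0 : 0 ≤ 4 * r ^ 2 * ∑ i : Fin m with k ≤ i.val, zipf γc m i * zipf γr m i :=
      mul_nonneg (by positivity) (Finset.sum_nonneg fun i _ =>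
        mul_nonneg (zipf_nonneg _ _ _) (zipf_nonneg _ _ _))
    refine mul_le_mul_of_nonneg_right ?_ h0
    exact_mod_cast (Finset.card_le_univ _).trans (Fintype.card_fin n).le
  refine (Finset.sum_le_sum fun v _ => hv v).trans ?_
  rw [Finset.sum_const, Finset.card_univ, Fintype.card_fin, nsmul_eq_mul]

/-- For `γc > 1` the caching normalisation is bounded and may be dropped, while the request
normalisation is at least `m ^ (1 - γr)`. What remains is a convergent tail with exponent `γc + γr`.
-/
theorem sum_zipf_mul_zipf_le (h0 : 0 ≤ γr) (hc : 1 < γc) [NeZero m] {k : ℕ} (hk : 1 ≤ k) :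
    ∑ i : Fin m with k ≤ i.val, zipf γc m i * zipf γr m i ≤
      (k : ℝ) ^ (1 - (γc + γr)) / (γc + γr - 1) / (m : ℝ) ^ (1 - γr) := by
  have hm : (0 : ℝ) < m := by exact_mod_cast NeZero.pos m
  have h1 : ∀ i : Fin m, zipf γc m i * zipf γr m i ≤
      1 / ((i : ℝ) + 1) ^ (γc + γr) / (m : ℝ) ^ (1 - γr) := by
    intro i
    have hi : (0 : ℝ) < (i : ℝ) + 1 := by positivity
    have a : zipf γc m i ≤ 1 / ((i : ℝ) + 1) ^ γc :=
      div_le_self (by positivity) (one_le_zipf_denom γc m)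
    have b : zipf γr m i ≤ 1 / ((i : ℝ) + 1) ^ γr / (m : ℝ) ^ (1 - γr) :=
      div_le_div_of_nonneg_left (by positivity) (by positivity) (le_zipf_denom h0 m)
    refine (mul_le_mul a b (zipf_nonneg _ _ _) (by positivity)).trans (le_of_eq ?_)
    rw [Real.rpow_add hi]
    field_simp
  refine (Finset.sum_le_sum fun i _ => h1 i).trans ?_
  rw [← Finset.sum_div]
  refine div_le_div_of_nonneg_right ?_ (by positivity)
  refine le_trans ?_ (sum_Ico_one_div_rpow_le (by linarith) hk m)
  refine le_trans (le_of_eq (Finset.sum_map (Finset.univ.filter fun i : Fin m => k ≤ i.val)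
    Fin.valEmbedding (fun j : ℕ => 1 / ((j : ℝ) + 1) ^ (γc + γr))).symm) ?_
  refine Finset.sum_le_sum_of_subset_of_nonneg ?_ (fun _ _ _ => by positivity)
  intro j hj
  obtain ⟨i, hi, rfl⟩ := Finset.mem_map.1 hj
  exact Finset.mem_Ico.2 ⟨(Finset.mem_filter.1 hi).2, i.2⟩

/-- The rank up to which files are typically cached in a cell with `m ^ θ` users. -/
theorem rpow_cutoff {θ : ℝ} (hm : 0 < m) (hc : 0 < γc)
    (hθ : (1 - γr) * γc = θ * (1 - γr + γc)) :
    (((m : ℝ) ^ θ) ^ (1 / γc)) ^ γc = (m : ℝ) ^ θ ∧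
      (((m : ℝ) ^ θ) ^ (1 / γc)) ^ (1 - γr) = (m : ℝ) ^ (1 - γr) / (m : ℝ) ^ θ := by
  have hm : (0 : ℝ) < m := by exact_mod_cast hm
  constructor
  · rw [← Real.rpow_mul (by positivity), one_div, inv_mul_cancel₀ hc.ne', Real.rpow_one]
  · rw [← Real.rpow_mul hm.le, ← Real.rpow_mul hm.le, ← Real.rpow_sub hm]
    congr 1
    field_simp
    linarith

/-- Cutting at `q = M ^ (1 / γc)` balances the two contributions: popular requests have probability
of order `1 / M`, and the expected number of users in range holding an unpopular requested file is
of the same order. -/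
theorem expectedActiveLinks_zipfCaching_le {θ c₄ : ℝ} (h0 : 0 ≤ γr) (h1 : γr < 1) (hc : 1 < γc)
    (hθ0 : 0 ≤ θ) (hθ : (1 - γr) * γc = θ * (1 - γr + γc)) [NeZero m] (hn : 0 < n) (hr : 0 ≤ r)
    (hrle : r ≤ c₄ * √((m : ℝ) ^ θ / n)) :
    expectedActiveLinks γr r (zipfCaching n m γc) ≤
      (4 / (1 - γr) + 4 * c₄ ^ 2 / (γc + γr - 1)) * ((n : ℝ) / (m : ℝ) ^ θ) := by
  have hm : (0 : ℝ) < m := by exact_mod_cast NeZero.pos m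
  have hm1 : (1 : ℝ) ≤ m := by exact_mod_cast NeZero.pos m
  have hn0 : (0 : ℝ) < n := by exact_mod_cast hn
  have hγ : 0 < 1 - γr := by linarith
  have hβ : 0 < γc + γr - 1 := by linarith
  obtain ⟨q1, q2⟩ := rpow_cutoff (γr := γr) (γc := γc) (NeZero.pos m) (by linarith) hθ
  set M : ℝ := (m : ℝ) ^ θ with hM
  have hM0 : 0 < M := by positivity
  have hM1 : 1 ≤ M := Real.one_le_rpow hm1 hθ0
  set q : ℝ := M ^ (1 / γc) with hq
  have hq1 : 1 ≤ q := Real.one_le_rpow hM1 (by positivity)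
  have hq0 : 0 < q := by linarith
  set k : ℕ := ⌈q⌉₊ with hk
  have hk1 : 1 ≤ k := Nat.one_le_ceil_iff.2 hq0
  have hqk : q ≤ k := Nat.le_ceil q
  have hk0 : (0 : ℝ) < k := by linarith
  have hkq : (k : ℝ) ≤ 2 * q := by
    have := Nat.ceil_lt_add_one (a := q) hq0.le
    linarith
  refine (expectedActiveLinks_zipfCaching_le_sum hr k).trans ?_
  have hF : ∑ i : Fin m with i.val < k, zipf γr m i ≤ 4 / (1 - γr) / M := by
    refine (sum_zipf_le h0 h1 m hk1 _).trans ?_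
    have hcard : ((Finset.univ.filter fun i : Fin m => i.val < k).card : ℝ) ≤ k := by
      have := Finset.card_le_card_of_injOn (s := Finset.univ.filter fun i : Fin m => i.val < k)
        (t := Finset.range k) (fun i => (i : ℕ))
        (fun i hi => Finset.mem_range.2 (Finset.mem_filter.1 hi).2)
        (fun i _ j _ h => Fin.ext h)
      rw [Finset.card_range] at this
      exact_mod_cast this
    have hpow : ((k : ℝ) / m) ^ (1 - γr) ≤ 2 / M := by
      rw [Real.div_rpow hk0.le hm.le, div_le_iff₀ (by positivity)]
      calc (k : ℝ) ^ (1 - γr) ≤ (2 * q) ^ (1 - γr) := by gcongr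
        _ = 2 ^ (1 - γr) * q ^ (1 - γr) := Real.mul_rpow (by norm_num) hq0.le
        _ ≤ 2 ^ (1 : ℝ) * q ^ (1 - γr) := by
            gcongr
            · norm_num
            · linarith
        _ = _ := by rw [q2, Real.rpow_one]; field_simp
    have h2 : 1 + ((Finset.univ.filter fun i : Fin m => i.val < k).card : ℝ) / k ≤ 2 := by
      have := (div_le_one hk0).2 hcard
      linarith
    calc _ ≤ 1 / (1 - γr) * (2 / M) * 2 := by gcongr
      _ = _ := by ring
  have hT : ∑ i : Fin m with k ≤ i.val, zipf γc m i * zipf γr m i ≤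
      1 / (γc + γr - 1) / M ^ 2 := by
    refine (sum_zipf_mul_zipf_le h0 hc hk1).trans ?_
    have e : (k : ℝ) ^ (1 - (γc + γr)) ≤ q ^ (1 - γr) / q ^ γc := by
      rw [← Real.rpow_sub hq0]
      have : 1 - (γc + γr) = 1 - γr - γc := by ring
      rw [this]
      exact Real.rpow_le_rpow_of_nonpos hq0 hqk (by linarith)
    calc _ ≤ q ^ (1 - γr) / q ^ γc / (γc + γr - 1) / (m : ℝ) ^ (1 - γr) := by gcongr
      _ = _ := by rw [q1, q2]; field_simp
  have hT0 : 0 ≤ ∑ i : Fin m with k ≤ i.val, zipf γc m i * zipf γr m i :=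
    Finset.sum_nonneg fun i _ => mul_nonneg (zipf_nonneg _ _ _) (zipf_nonneg _ _ _)
  have hr2 : r ^ 2 ≤ c₄ ^ 2 * (M / n) := by
    calc r ^ 2 ≤ (c₄ * √(M / n)) ^ 2 := by gcongr
      _ = _ := by rw [mul_pow, Real.sq_sqrt (by positivity)]
  calc _ ≤ n * (4 / (1 - γr) / M +
        n * (4 * (c₄ ^ 2 * (M / n)) * (1 / (γc + γr - 1) / M ^ 2))) := by
        gcongr
    _ = _ := by field_simp

end ZipfCachingUpper

/-! ### Matching offers with demands in two independent groups. -/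

section Matching

theorem one_sub_exp_neg_ge {x : ℝ} (hx : 0 ≤ x) : x / (1 + x) ≤ 1 - Real.exp (-x) := by
  have h1 : Real.exp (-x) ≤ 1 / (1 + x) := by
    rw [Real.exp_neg, ← one_div]
    exact one_div_le_one_div_of_le (by linarith) (by linarith [Real.add_one_le_exp x])
  have h2 : x / (1 + x) = 1 - 1 / (1 + x) := by field_simp; ring
  linarith

variable {Ω : Type*} [MeasurableSpace Ω] {τ : Measure Ω} [IsProbabilityMeasure τ]

/-- Probability that at least one of finitely many independent trials succeeds. -/
theorem le_pi_real_exists {ι : Type*} [Fintype ι] {D : Set Ω} (hD : MeasurableSet D) {δ : ℝ}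
    (hδ0 : 0 ≤ δ) (hδ : δ ≤ τ.real D) :
    Fintype.card ι * δ / (1 + Fintype.card ι * δ) ≤
      (Measure.pi fun _ : ι => τ).real {z | ∃ v, z v ∈ D} := by
  have e : {z : ι → Ω | ∃ v, z v ∈ D} = (Set.univ.pi fun _ => Dᶜ)ᶜ := by
    ext z; simp
  rw [e, probReal_compl_eq_one_sub (MeasurableSet.univ_pi fun _ => hD.compl), Measure.real,
    Measure.pi_pi, Finset.prod_const, Finset.card_univ, ENNReal.toReal_pow]
  change _ ≤ 1 - τ.real Dᶜ ^ Fintype.card ι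
  rw [probReal_compl_eq_one_sub hD]
  refine (one_sub_exp_neg_ge (by positivity)).trans ?_
  have h1 : 0 ≤ 1 - τ.real D := by linarith [measureReal_le_one (μ := τ) (s := D)]
  have h2 : (1 - τ.real D) ^ Fintype.card ι ≤ Real.exp (-(Fintype.card ι * δ)) := by
    rw [← mul_neg, Real.exp_nat_mul]
    refine pow_le_pow_left₀ h1 ?_ _
    linarith [Real.add_one_le_exp (-δ)]
  linarith

/-- Two disjoint groups of independent users: probability that one user of the first group offers
what a user of the second group is looking for. -/
theorem le_pi_real_exists_match {n : ℕ} {κ : Type*} (T : Fin n → Prop) [DecidablePred T]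
    (I : Finset κ) {A B : κ → Set Ω} (hA : ∀ i, MeasurableSet (A i))
    (hB : ∀ i, MeasurableSet (B i)) (hBd : (I : Set κ).PairwiseDisjoint B) {α β : ℝ}
    (hα0 : 0 ≤ α) (hβ0 : 0 ≤ β)
    (hα : ∀ i ∈ I, α ≤ τ.real (A i)) (hβ : ∀ i ∈ I, β ≤ τ.real (B i)) {t v : ℕ}
    (ht : t = Fintype.card {u // T u}) (hv : v = Fintype.card {u // ¬ T u}) :
    t * α / (1 + t * α) * (v * β * I.card / (1 + v * β * I.card)) ≤
      (Measure.pi fun _ : Fin n => τ).real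
        {z | ∃ i ∈ I, (∃ u, T u ∧ z u ∈ A i) ∧ ∃ u, ¬ T u ∧ z u ∈ B i} := by
  classical
  set P₁ : Measure ({u // T u} → Ω) := Measure.pi fun _ => τ
  set P₂ : Measure ({u // ¬ T u} → Ω) := Measure.pi fun _ => τ
  let G : Set (({u // T u} → Ω) × ({u // ¬ T u} → Ω)) :=
    {q | ∃ i ∈ I, (∃ u, q.1 u ∈ A i) ∧ ∃ u, q.2 u ∈ B i}
  have hE : ∀ i, MeasurableSet {y : {u // T u} → Ω | ∃ u, y u ∈ A i} := fun i => by
    have : {y : {u // T u} → Ω | ∃ u, y u ∈ A i} = ⋃ u, (fun y => y u) ⁻¹' A i := by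
      ext; simp
    rw [this]
    exact MeasurableSet.iUnion fun u => (hA i).preimage (measurable_pi_apply u)
  have hF : ∀ i, MeasurableSet {y : {u // ¬ T u} → Ω | ∃ u, y u ∈ B i} := fun i => by
    have : {y : {u // ¬ T u} → Ω | ∃ u, y u ∈ B i} = ⋃ u, (fun y => y u) ⁻¹' B i := by
      ext; simp
    rw [this]
    exact MeasurableSet.iUnion fun u => (hB i).preimage (measurable_pi_apply u)
  have hG : MeasurableSet G := by
    have : G = ⋃ i ∈ I, {y | ∃ u, y u ∈ A i} ×ˢ {y | ∃ u, y u ∈ B i} := by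
      ext q; simp [G, and_left_comm]
    rw [this]
    exact Finset.measurableSet_biUnion _ fun i _ => (hE i).prod (hF i)
  have hmp := measurePreserving_piEquivPiSubtypeProd (fun _ : Fin n => τ) T
  have hpre : {z : Fin n → Ω | ∃ i ∈ I, (∃ u, T u ∧ z u ∈ A i) ∧ ∃ u, ¬ T u ∧ z u ∈ B i} =
      MeasurableEquiv.piEquivPiSubtypeProd (fun _ => Ω) T ⁻¹' G := by
    ext z
    simp [G, MeasurableEquiv.piEquivPiSubtypeProd, Equiv.piEquivPiSubtypeProd, exists_prop]
  rw [hpre, measureReal_def, hmp.measure_preimage hG.nullMeasurableSet, ← measureReal_def]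
  set x : ℝ := v * β * I.card with hx
  have hx0 : 0 ≤ x := by positivity
  have hind : (P₁.prod P₂).real G = ∫ y, P₂.real (Prod.mk y ⁻¹' G) ∂P₁ := by
    rw [← integral_indicator_one hG, integral_prod _ ((integrable_const _).indicator hG)]
    refine integral_congr_ae (ae_of_all _ fun y => ?_)
    exact integral_indicator_one (measurable_prodMk_left hG)
  rw [hind]
  let W : ({u // T u} → Ω) → Finset κ := fun y => I.filter fun i => ∃ u, y u ∈ A i
  -- Given the first group, `W y` is the set of offered files. Using `|W y| ≤ |I|` in the
  -- denominator makes the bound linear in `|W y|`, so only its mean matters and no independence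
  -- between different files is needed.
  have hslice : ∀ y, v * β / (1 + x) *
      ∑ i ∈ I, {y : {u // T u} → Ω | ∃ u, y u ∈ A i}.indicator (fun _ => (1 : ℝ)) y ≤
        P₂.real (Prod.mk y ⁻¹' G) := by
    intro y
    have e1 : ∑ i ∈ I, {y : {u // T u} → Ω | ∃ u, y u ∈ A i}.indicator (fun _ => (1 : ℝ)) y =
        (W y).card := by
      simp only [W, Finset.card_filter, Nat.cast_sum, Set.indicator_apply]
      refine Finset.sum_congr rfl fun i _ => ?_
      simp
    have e2 : Prod.mk y ⁻¹' G = {z : {u // ¬ T u} → Ω | ∃ u, z u ∈ ⋃ i ∈ W y, B i} := by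
      ext z
      simp only [G, W, Set.mem_preimage, Set.mem_ofPred_eq, Set.mem_iUnion, Finset.mem_filter,
        exists_prop]
      constructor
      · rintro ⟨i, hi, ha, u, hu⟩
        exact ⟨u, i, ⟨hi, ha⟩, hu⟩
      · rintro ⟨u, i, ⟨hi, ha⟩, hu⟩
        exact ⟨i, hi, ha, u, hu⟩
    have hWI : W y ⊆ I := Finset.filter_subset _ _
    have hδ : (W y).card * β ≤ τ.real (⋃ i ∈ W y, B i) := by
      rw [measureReal_biUnion_finset (hBd.subset (by exact_mod_cast hWI)) fun i _ => hB i,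
        ← nsmul_eq_mul]
      exact Finset.card_nsmul_le_sum _ _ _ fun i hi => hβ i (hWI hi)
    have h3 := le_pi_real_exists (ι := {u // ¬ T u}) (τ := τ)
      (Finset.measurableSet_biUnion (W y) fun i _ => hB i) (by positivity) hδ
    rw [e1, e2]
    refine le_trans ?_ h3
    rw [← hv]
    have hWc : ((W y).card : ℝ) ≤ I.card := by exact_mod_cast Finset.card_le_card hWI
    have h4 : v * (((W y).card : ℝ) * β) ≤ x := by
      rw [hx]
      calc v * (((W y).card : ℝ) * β) ≤ v * ((I.card : ℝ) * β) := by gcongr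
        _ = _ := by ring
    calc v * β / (1 + x) * ((W y).card : ℝ) = v * (((W y).card : ℝ) * β) / (1 + x) := by ring
      _ ≤ _ := by gcongr
  have hi1 : ∀ i ∈ I, Integrable ({y : {u // T u} → Ω | ∃ u, y u ∈ A i}.indicator
      fun _ => (1 : ℝ)) P₁ := fun i _ => (integrable_const _).indicator (hE i)
  have hmeas : Integrable (fun y => P₂.real (Prod.mk y ⁻¹' G)) P₁ := by
    refine Integrable.of_bound (C := 1) ?_ (ae_of_all _ fun y => ?_)
    · exact (measurable_measure_prodMk_left hG).ennreal_toReal.aestronglyMeasurable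
    · rw [Real.norm_of_nonneg measureReal_nonneg]; exact measureReal_le_one
  refine le_trans ?_ (integral_mono ((integrable_finsetSum _ hi1).const_mul _) hmeas hslice)
  rw [integral_const_mul, integral_finsetSum _ hi1]
  have h5 : ∀ i ∈ I, t * α / (1 + t * α) ≤
      ∫ y, {y : {u // T u} → Ω | ∃ u, y u ∈ A i}.indicator (fun _ => (1 : ℝ)) y ∂P₁ := by
    intro i hi
    rw [integral_indicator (hE i), setIntegral_const, smul_eq_mul, mul_one, ht]
    exact le_pi_real_exists (hA i) hα0 (hα i hi)
  have h6 := Finset.card_nsmul_le_sum _ _ _ h5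
  rw [nsmul_eq_mul] at h6
  calc _ = v * β / (1 + x) * ((I.card : ℝ) * (t * α / (1 + t * α))) := by rw [hx]; ring
    _ ≤ _ := by gcongr

end Matching

/-! ### Lower bound for Zipf caching from separated squares. -/

section ZipfCachingLower

variable {n m : ℕ} {γr γc r : ℝ}

/-- Squares of side `r / 2`, placed at distance more than `r` from each other. -/
def separatedCell (r : ℝ) (c : ℕ × ℕ) : Set Plane :=
  {y | y 0 ∈ Set.Ico (4 * r * c.1) (4 * r * c.1 + r / 2) ∧
    y 1 ∈ Set.Ico (4 * r * c.2) (4 * r * c.2 + r / 2)}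

theorem dist_lt_of_mem_separatedCell (hr : 0 < r) {c : ℕ × ℕ} {y z : Plane}
    (hy : y ∈ separatedCell r c) (hz : z ∈ separatedCell r c) : dist y z < r := by
  refine lt_of_pow_lt_pow_left₀ 2 hr.le ?_
  rw [dist_sq_plane]
  obtain ⟨⟨a1, a2⟩, a3, a4⟩ := hy
  obtain ⟨⟨b1, b2⟩, b3, b4⟩ := hz
  have h0 : (y 0 - z 0) ^ 2 ≤ (r / 2) ^ 2 := sq_le_sq' (by linarith) (by linarith)
  have h1 : (y 1 - z 1) ^ 2 ≤ (r / 2) ^ 2 := sq_le_sq' (by linarith) (by linarith)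
  nlinarith

theorem lt_dist_of_mem_separatedCell (hr : 0 < r) {c c' : ℕ × ℕ} (hc : c ≠ c') {y z : Plane}
    (hy : y ∈ separatedCell r c) (hz : z ∈ separatedCell r c') : r < dist y z := by
  have key : ∀ (i j : ℕ) (a b : ℝ), i ≠ j → a ∈ Set.Ico (4 * r * i) (4 * r * i + r / 2) →
      b ∈ Set.Ico (4 * r * j) (4 * r * j + r / 2) → r < |a - b| := by
    intro i j a b hij ha hb
    rcases lt_or_gt_of_ne hij with h | h
    · have : (i : ℝ) + 1 ≤ j := by exact_mod_cast h
      have : 4 * r * (i + 1) ≤ 4 * r * j := by gcongr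
      refine lt_of_lt_of_le ?_ (neg_le_abs _)
      linarith [ha.2, hb.1]
    · have : (j : ℝ) + 1 ≤ i := by exact_mod_cast h
      have : 4 * r * (j + 1) ≤ 4 * r * i := by gcongr
      refine lt_of_lt_of_le ?_ (le_abs_self _)
      linarith [ha.1, hb.2]
  by_cases h0 : c.1 = c'.1
  · have h1 : c.2 ≠ c'.2 := fun h => hc (Prod.ext h0 h)
    exact (key _ _ _ _ h1 hy.2 hz.2).trans_le (abs_sub_le_dist y z 1)
  · exact (key _ _ _ _ h0 hy.1 hz.1).trans_le (abs_sub_le_dist y z 0)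

theorem measurableSet_separatedCell (r : ℝ) (c : ℕ × ℕ) : MeasurableSet (separatedCell r c) :=
  (measurableSet_Ico.preimage (by fun_prop : Measurable fun y : Plane => y 0)).inter
    (measurableSet_Ico.preimage (by fun_prop : Measurable fun y : Plane => y 1))

theorem positionLaw_separatedCell (hr : 0 < r) {q : ℕ} (hq : 4 * r * q ≤ 1) {c : ℕ × ℕ}
    (h1 : c.1 < q) (h2 : c.2 < q) : positionLaw.real (separatedCell r c) = (r / 2) ^ 2 := by
  have hb : ∀ i : ℕ, i < q → ∀ a ∈ Set.Ico (4 * r * i) (4 * r * i + r / 2),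
      a ∈ Set.Icc (0 : ℝ) 1 := by
    intro i hi a ha
    have : (i : ℝ) + 1 ≤ q := by exact_mod_cast hi
    have : 4 * r * (i + 1) ≤ 4 * r * q := by gcongr
    have h0 : 0 ≤ 4 * r * i := by positivity
    exact ⟨h0.trans ha.1, by linarith [ha.2]⟩
  have hsub : separatedCell r c ⊆ unitCell := by
    intro y hy i
    fin_cases i
    · exact hb _ h1 _ hy.1
    · exact hb _ h2 _ hy.2
  rw [Measure.real, positionLaw, Measure.restrict_apply (measurableSet_separatedCell r c),
    Set.inter_eq_left.2 hsub, separatedCell, volume_plane_box, Real.volume_Ico, Real.volume_Ico,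
    add_sub_cancel_left, add_sub_cancel_left, ← ENNReal.ofReal_mul (by positivity),
    ENNReal.toReal_ofReal (by positivity), sq]

/-- The event that, inside the set `Q`, a user of the group `T` caches a file of `I` that a user
outside the group requests and does not cache. -/
def serviceEvent (n : ℕ) {m : ℕ} (T : Fin n → Prop) (I : Finset (Fin m)) (Q : Set Plane) :
    Set (((Fin n → Plane) × (Fin n → Fin m)) × (Fin n → Fin m)) :=
  {ω | ∃ i ∈ I, (∃ u, T u ∧ ω.1.1 u ∈ Q ∧ ω.1.2 u = i) ∧
    ∃ v, ¬ T v ∧ ω.1.1 v ∈ Q ∧ ω.2 v = i ∧ ω.1.2 v ≠ i}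

theorem measurableSet_serviceEvent (T : Fin n → Prop) (I : Finset (Fin m)) {Q : Set Plane}
    (hQ : MeasurableSet Q) : MeasurableSet (serviceEvent n T I Q) := by
  have hx : ∀ u, MeasurableSet {ω : ((Fin n → Plane) × (Fin n → Fin m)) × (Fin n → Fin m) |
      ω.1.1 u ∈ Q} := fun u =>
    hQ.preimage ((measurable_pi_apply u).comp (measurable_fst.comp measurable_fst))
  have hw : ∀ s : Set (Fin n → Fin m),
      MeasurableSet {ω : ((Fin n → Plane) × (Fin n → Fin m)) × (Fin n → Fin m) | ω.1.2 ∈ s} :=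
    fun s => s.toFinite.measurableSet.preimage (measurable_snd.comp measurable_fst)
  have hf : ∀ s : Set (Fin n → Fin m),
      MeasurableSet {ω : ((Fin n → Plane) × (Fin n → Fin m)) × (Fin n → Fin m) | ω.2 ∈ s} :=
    fun s => s.toFinite.measurableSet.preimage measurable_snd
  have e : serviceEvent n T I Q = ⋃ i ∈ I,
      ((⋃ u, {ω | T u} ∩ ({ω | ω.1.1 u ∈ Q} ∩ {ω | ω.1.2 ∈ {w | w u = i}})) ∩
        ⋃ v, {ω | ¬ T v} ∩ ({ω | ω.1.1 v ∈ Q} ∩ ({ω | ω.2 ∈ {f | f v = i}} ∩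
          {ω | ω.1.2 ∈ {w | w v ≠ i}}))) := by
    ext ω
    simp only [serviceEvent, Set.mem_ofPred_eq, Set.mem_iUnion, Set.mem_inter_iff, exists_prop]
  rw [e]
  refine Finset.measurableSet_biUnion _ fun i _ => (MeasurableSet.iUnion fun u => ?_).inter
    (MeasurableSet.iUnion fun v => ?_)
  · exact (MeasurableSet.const _).inter ((hx u).inter (hw _))
  · exact (MeasurableSet.const _).inter ((hx v).inter ((hf _).inter (hw _)))

/-- Regrouping position, cache and request of each user into one triple makes the users independent
and identically distributed, so the matching estimate applies. The demand sets are disjoint because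
a user requests one file. -/
theorem le_networkLaw_serviceEvent [NeZero m] (T : Fin n → Prop) [DecidablePred T]
    (I : Finset (Fin m)) {Q : Set Plane} (hQ : MeasurableSet Q) {p pc pr : ℝ} (hpc0 : 0 ≤ pc)
    (hpr0 : 0 ≤ pr) (hp : positionLaw.real Q = p) (hpc : ∀ i ∈ I, pc ≤ zipf γc m i)
    (hpr : ∀ i ∈ I, pr ≤ (1 - zipf γc m i) * zipf γr m i) {t v : ℕ}
    (ht : t = Fintype.card {u // T u}) (hv : v = Fintype.card {u // ¬ T u}) :
    t * (p * pc) / (1 + t * (p * pc)) *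
        (v * (p * pr) * I.card / (1 + v * (p * pr) * I.card)) ≤
      (networkLaw γr (zipfCaching n m γc)).real (serviceEvent n T I Q) := by
  set τ : Measure ((Plane × Fin m) × Fin m) :=
    (positionLaw.prod (zipfLaw γc m)).prod (zipfLaw γr m) with hτ
  have hp0 : 0 ≤ p := hp ▸ measureReal_nonneg
  have hz : ∀ (γ : ℝ) (i : Fin m), (zipfLaw γ m).real {i} = zipf γ m i := by
    intro γ i
    classical
    rw [Measure.real, zipfLaw_apply,
      ENNReal.toReal_ofReal (Finset.sum_nonneg fun i _ => zipf_nonneg γ m i)]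
    simp [Finset.filter_eq']
  let A : Fin m → Set ((Plane × Fin m) × Fin m) := fun i => (Q ×ˢ {i}) ×ˢ Set.univ
  let B : Fin m → Set ((Plane × Fin m) × Fin m) := fun i => (Q ×ˢ {i}ᶜ) ×ˢ {i}
  have hmatch := le_pi_real_exists_match (τ := τ) T I (A := A) (B := B)
    (α := p * pc) (β := p * pr)
    (fun i => (hQ.prod (measurableSet_singleton i)).prod MeasurableSet.univ)
    (fun i => (hQ.prod (measurableSet_singleton i).compl).prod (measurableSet_singleton i))
    (by
      intro i _ j _ hij
      refine Set.disjoint_left.2 fun z hz hz' => hij ?_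
      exact (show z.2 = i from hz.2).symm.trans hz'.2)
    (by positivity) (by positivity)
    (by
      intro i hi
      simp only [A, hτ]
      rw [measureReal_prod_prod, measureReal_prod_prod, hp, hz, probReal_univ, mul_one]
      exact mul_le_mul_of_nonneg_left (hpc i hi) hp0)
    (by
      intro i hi
      simp only [B, hτ]
      rw [measureReal_prod_prod, measureReal_prod_prod, hp, hz,
        probReal_compl_eq_one_sub (measurableSet_singleton i), hz, mul_assoc]
      exact mul_le_mul_of_nonneg_left (hpr i hi) hp0)
    ht hv
  refine hmatch.trans (le_of_eq ?_)
  have m1 := measurePreserving_arrowProdEquivProdArrow (Plane × Fin m) (Fin m) (Fin n)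
    (fun _ => positionLaw.prod (zipfLaw γc m)) (fun _ => zipfLaw γr m)
  have m2 := measurePreserving_arrowProdEquivProdArrow Plane (Fin m) (Fin n)
    (fun _ => positionLaw) (fun _ => zipfLaw γc m)
  have m3 := (m2.prod (MeasurePreserving.id (Measure.pi fun _ : Fin n => zipfLaw γr m))).comp m1
  rw [networkLaw_zipfCaching, measureReal_def, measureReal_def,
    ← m3.measure_preimage (measurableSet_serviceEvent T I hQ).nullMeasurableSet]
  congr 2
  ext z
  simp only [serviceEvent, A, B, Set.mem_ofPred_eq, Set.mem_preimage, Set.mem_prod,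
    Set.mem_singleton_iff, Set.mem_univ, and_true, Set.mem_compl_iff]
  refine exists_congr fun i => and_congr Iff.rfl (and_congr Iff.rfl (exists_congr fun v =>
    and_congr Iff.rfl ?_))
  constructor
  · rintro ⟨⟨h1, h2⟩, h3⟩
    exact ⟨h1, h3, h2⟩
  · rintro ⟨h1, h3, h2⟩
    exact ⟨⟨h1, h2⟩, h3⟩

/-- One link is chosen in each successful square. Its ends are in range because the square is small,
and different squares are too far apart to interfere. -/
theorem card_serviceEvent_le_numActiveLinks (hr : 0 < r) (T : Fin n → Prop) (I : Finset (Fin m))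
    (S : Finset (ℕ × ℕ)) (ω : ((Fin n → Plane) × (Fin n → Fin m)) × (Fin n → Fin m))
    [DecidablePred fun c => ω ∈ serviceEvent n T I (separatedCell r c)] :
    (S.filter fun c => ω ∈ serviceEvent n T I (separatedCell r c)).card ≤
      numActiveLinks r ω.1.1 ω.1.2 ω.2 := by
  classical
  have hlink : ∀ c, ω ∈ serviceEvent n T I (separatedCell r c) → ∃ l : Link n,
      l ∈ potentialLinks r ω.1.1 ω.1.2 ω.2 ∧ ω.1.1 l.1 ∈ separatedCell r c ∧
        ω.1.1 l.2 ∈ separatedCell r c := by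
    rintro c ⟨i, _, ⟨u, hu, hux, huw⟩, v, hv, hvx, hvf, hvw⟩
    refine ⟨(u, v), ⟨fun h => hv ?_, dist_lt_of_mem_separatedCell hr hux hvx, ?_, ?_⟩, hux, hvx⟩
    · simp only at h
      exact h ▸ hu
    · simp only [huw, hvf]
    · simp only [hvf]; exact hvw
  set S' := S.filter fun c => ω ∈ serviceEvent n T I (separatedCell r c)
  rcases S'.eq_empty_or_nonempty with hempty | ⟨c₀, hc₀⟩
  · rw [hempty, Finset.card_empty]; exact Nat.zero_le _
  have : Nonempty (Link n) := ⟨(hlink c₀ (Finset.mem_filter.1 hc₀).2).choose⟩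
  choose! l hl h1 h2 using hlink
  have hS' : ∀ c ∈ S', ω ∈ serviceEvent n T I (separatedCell r c) := fun c hc =>
    (Finset.mem_filter.1 hc).2
  have hsep : ∀ c ∈ S', ∀ c' ∈ S', c ≠ c' → r < dist (ω.1.1 (l c).1) (ω.1.1 (l c').2) :=
    fun c hc c' hc' hne =>
      lt_dist_of_mem_separatedCell hr hne (h1 c (hS' c hc)) (h2 c' (hS' c' hc'))
  have hinj : Set.InjOn l S' := by
    intro c hc c' hc' he
    by_contra hne
    have a1 := hsep c hc c' hc' hne
    have a2 := dist_lt_of_mem_separatedCell hr (h1 c (hS' c hc)) (h2 c (hS' c hc))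
    rw [he] at a1 a2
    exact lt_asymm a1 a2
  rw [← Finset.card_image_of_injOn hinj]
  refine card_le_numActiveLinks ?_ ?_
  · intro k hk
    obtain ⟨c, hc, rfl⟩ := Finset.mem_image.1 hk
    exact hl c (hS' c hc)
  · intro k hk k' hk' hne
    obtain ⟨c, hc, rfl⟩ := Finset.mem_image.1 hk
    obtain ⟨c', hc', rfl⟩ := Finset.mem_image.1 hk'
    exact hsep c hc c' hc' fun h => hne (by rw [h])

theorem le_expectedActiveLinks_of_serviceEvent [NeZero m] (hr : 0 < r) (T : Fin n → Prop)
    (I : Finset (Fin m)) (S : Finset (ℕ × ℕ)) {P : ℝ}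
    (hP : ∀ c ∈ S, P ≤ (networkLaw γr (zipfCaching n m γc)).real
      (serviceEvent n T I (separatedCell r c))) :
    S.card * P ≤ expectedActiveLinks γr r (zipfCaching n m γc) := by
  classical
  set μ := networkLaw γr (zipfCaching n m γc) with hμ
  have hprob : IsProbabilityMeasure μ := by rw [hμ]; unfold networkLaw; infer_instance
  have hmeas : ∀ c, MeasurableSet (serviceEvent n T I (separatedCell r c)) := fun c =>
    measurableSet_serviceEvent T I (measurableSet_separatedCell r c)
  have hint : ∀ c ∈ S, Integrable ((serviceEvent n T I (separatedCell r c)).indicator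
      fun _ => (1 : ℝ)) μ := fun c _ => (integrable_const _).indicator (hmeas c)
  have h1 : ∫ ω, ∑ c ∈ S, (serviceEvent n T I (separatedCell r c)).indicator
      (fun _ => (1 : ℝ)) ω ∂μ ≤ expectedActiveLinks γr r (zipfCaching n m γc) := by
    refine integral_mono (integrable_finsetSum _ hint) (integrable_numActiveLinks _) fun ω => ?_
    have := card_serviceEvent_le_numActiveLinks hr T I S ω
    have h2 : ((S.filter fun c => ω ∈ serviceEvent n T I (separatedCell r c)).card : ℝ) ≤
      numActiveLinks r ω.1.1 ω.1.2 ω.2 := by exact_mod_cast this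
    refine le_trans (le_of_eq ?_) h2
    simp only [Finset.card_filter, Nat.cast_sum, Set.indicator_apply]
    refine Finset.sum_congr rfl fun c _ => ?_
    simp
  refine le_trans ?_ h1
  rw [integral_finsetSum _ hint, ← nsmul_eq_mul]
  refine Finset.card_nsmul_le_sum _ _ _ fun c hc => ?_
  rw [integral_indicator (hmeas c), setIntegral_const, smul_eq_mul, mul_one]
  exact hP c hc

/-- The top file is at least as likely, and the two probabilities sum to at most 1. Hence a
requester of such a file lacks it in its own cache with probability at least one half. -/
theorem zipf_le_half (h0 : 0 ≤ γc) {i : Fin m} (hi : 1 ≤ i.val) : zipf γc m i ≤ 1 / 2 := by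
  have : NeZero m := ⟨by have := i.2; omega⟩
  have hne : (0 : Fin m) ≠ i := fun h => by
    rw [← h] at hi; simp at hi
  have hle : zipf γc m i ≤ zipf γc m 0 := by
    unfold zipf
    refine div_le_div_of_nonneg_right ?_ (zipf_denom_pos γc m).le
    refine one_div_le_one_div_of_le (by positivity) (Real.rpow_le_rpow (by positivity) ?_ h0)
    simp
  have hsum : zipf γc m 0 + zipf γc m i ≤ 1 := by
    rw [← sum_zipf γc m, ← Finset.sum_pair hne]
    exact Finset.sum_le_sum_of_subset_of_nonneg (Finset.subset_univ _)
      fun j _ _ => zipf_nonneg _ _ _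
  linarith

theorem card_filter_Ico_val {a b : ℕ} (h : b ≤ m) :
    (Finset.univ.filter fun i : Fin m => a ≤ i.val ∧ i.val < b).card = b - a := by
  rw [← Finset.card_map Fin.valEmbedding, ← Nat.card_Ico]
  congr 1
  ext j
  simp only [Finset.mem_map, Finset.mem_filter, Finset.mem_univ, true_and, Finset.mem_Ico,
    Fin.valEmbedding_apply]
  constructor
  · rintro ⟨i, hi, rfl⟩; exact hi
  · intro hj; exact ⟨⟨j, hj.2.trans_le h⟩, hj, rfl⟩

theorem div_one_add_le_div_one_add {x y : ℝ} (hx : 0 ≤ x) (h : x ≤ y) :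
    x / (1 + x) ≤ y / (1 + y) := by
  rw [div_le_div_iff₀ (by linarith) (by linarith)]
  nlinarith

theorem le_expectedActiveLinks_zipfCaching {θ c₃ c₄ : ℝ} (h0 : 0 ≤ γr) (h1 : γr < 1)
    (hc : 1 < γc) (hθ0 : 0 ≤ θ) (hθ : (1 - γr) * γc = θ * (1 - γr + γc)) [NeZero m] (hn : 2 ≤ n)
    (hc₃ : 0 < c₃) (hc₄ : 0 < c₄) (hm4 : 4 * ((m : ℝ) ^ θ) ^ (1 / γc) ≤ m)
    (hr4 : c₄ * √((m : ℝ) ^ θ / n) ≤ 1 / 4)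
    (hr₃ : c₃ * √((m : ℝ) ^ θ / n) ≤ r) (hr₄ : r ≤ c₄ * √((m : ℝ) ^ θ / n))
    {a b : ℝ} (ha : a = c₃ ^ 2 / (12 * 4 ^ γc * (1 + 1 / (γc - 1))))
    (hb : b = c₃ ^ 2 * (1 - γr) / 48) :
    1 / (64 * c₄ ^ 2) * (a / (1 + a) * (b / (1 + b))) * ((n : ℝ) / (m : ℝ) ^ θ) ≤
      expectedActiveLinks γr r (zipfCaching n m γc) := by
  classical
  have hm : (0 : ℝ) < m := by exact_mod_cast NeZero.pos m
  have hm1 : (1 : ℝ) ≤ m := by exact_mod_cast NeZero.pos m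
  have hn0 : (0 : ℝ) < n := by exact_mod_cast (by omega : 0 < n)
  have hγ : 0 < 1 - γr := by linarith
  have hγc : 0 < γc - 1 := by linarith
  obtain ⟨q1, q2⟩ := rpow_cutoff (γr := γr) (γc := γc) (NeZero.pos m) (by linarith) hθ
  set M : ℝ := (m : ℝ) ^ θ with hM
  have hM0 : 0 < M := by positivity
  have hM1 : 1 ≤ M := Real.one_le_rpow hm1 hθ0
  set q : ℝ := M ^ (1 / γc) with hq
  have hq1 : 1 ≤ q := Real.one_le_rpow hM1 (by positivity)
  have hq0 : 0 < q := by linarith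
  set k : ℕ := ⌈q⌉₊ with hk
  have hk1 : 1 ≤ k := Nat.one_le_ceil_iff.2 hq0
  have hqk : q ≤ k := Nat.le_ceil q
  have hk0 : (0 : ℝ) < k := by linarith
  have hkq : (k : ℝ) ≤ 2 * q := by
    have := Nat.ceil_lt_add_one (a := q) hq0.le
    linarith
  have h2km : 2 * k ≤ m := by
    have : 2 * (k : ℝ) ≤ m := by linarith
    exact_mod_cast this
  have hsq : 0 < √(M / n) := Real.sqrt_pos.2 (by positivity)
  have hr : 0 < r := lt_of_lt_of_le (by positivity) hr₃
  have hr2 : c₃ ^ 2 * (M / n) ≤ r ^ 2 := by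
    calc c₃ ^ 2 * (M / n) = (c₃ * √(M / n)) ^ 2 := by
          rw [mul_pow, Real.sq_sqrt (by positivity)]
      _ ≤ r ^ 2 := by gcongr
  have hr2' : r ^ 2 ≤ c₄ ^ 2 * (M / n) := by
    calc r ^ 2 ≤ (c₄ * √(M / n)) ^ 2 := by gcongr
      _ = _ := by rw [mul_pow, Real.sq_sqrt (by positivity)]
  -- The number of separated squares per side; as `1 / (4 * r) ≥ 1`, rounding down costs at most a
  -- factor 2.
  set d : ℕ := ⌊1 / (4 * r)⌋₊ with hd
  have hd1 : 1 ≤ 1 / (4 * r) := by rw [le_div_iff₀ (by positivity)]; linarith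
  have hdle : 4 * r * d ≤ 1 := by
    have := Nat.floor_le (a := 1 / (4 * r)) (by positivity)
    rw [le_div_iff₀ (by positivity)] at this
    linarith
  have hdge : 1 / (8 * r) ≤ d := by
    have h2 := Nat.lt_floor_add_one (1 / (4 * r))
    have h3 : 1 ≤ d := Nat.one_le_floor_iff _ |>.2 hd1
    have h3 : (1 : ℝ) ≤ d := by exact_mod_cast h3
    have e : 1 / (4 * r) = 2 * (1 / (8 * r)) := by field_simp; norm_num
    rw [← hd, e] at h2
    linarith
  -- On this block of `k` files around the cutoff, caching probabilities are at least of order `1 /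
  -- M` and the request probabilities sum to at least that order. Starting at `k ≥ 1` excludes the
  -- top file.
  set I : Finset (Fin m) := Finset.univ.filter fun i : Fin m => k ≤ i.val ∧ i.val < 2 * k with hI
  have hIcard : I.card = k := by
    rw [hI, card_filter_Ico_val h2km]; omega
  -- Splitting the users into prescribed transmitters and receivers gives independence; both groups
  -- have at least `n / 3` members because `n ≥ 2`.
  let T : Fin n → Prop := fun u => u.val < n / 2
  have ht : Fintype.card {u // T u} = n / 2 := by
    rw [Fintype.card_subtype, Fin.card_filter_val_lt]
    omega
  have hv : Fintype.card {u // ¬ T u} = n - n / 2 := by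
    rw [Fintype.card_subtype_compl, ht, Fintype.card_fin]
  have htn : (n : ℝ) / 3 ≤ ((n / 2 : ℕ) : ℝ) := by
    have : n ≤ 3 * (n / 2) := by omega
    have : (n : ℝ) ≤ 3 * ((n / 2 : ℕ) : ℝ) := by exact_mod_cast this
    linarith
  have hvn : (n : ℝ) / 3 ≤ ((n - n / 2 : ℕ) : ℝ) := by
    have : n ≤ 3 * (n - n / 2) := by omega
    have : (n : ℝ) ≤ 3 * ((n - n / 2 : ℕ) : ℝ) := by exact_mod_cast this
    linarith
  have hrank : ∀ i ∈ I, (i : ℝ) + 1 ≤ 2 * k := by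
    intro i hi
    have := (Finset.mem_filter.1 hi).2.2
    exact_mod_cast this
  set Z : ℝ := 1 + 1 / (γc - 1) with hZ
  have hZ0 : 0 < Z := by positivity
  set pc : ℝ := 1 / (4 ^ γc * M) / Z with hpc
  set pr : ℝ := 1 / 2 * (1 / (2 * (k : ℝ)) ^ γr / ((m : ℝ) ^ (1 - γr) / (1 - γr))) with hpr
  have hpcI : ∀ i ∈ I, pc ≤ zipf γc m i := by
    intro i hi
    have e : (4 : ℝ) ^ γc * M = (4 * q) ^ γc := by
      rw [Real.mul_rpow (by norm_num) hq0.le, q1]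
    have h3 : ((i : ℝ) + 1) ^ γc ≤ (4 * q) ^ γc :=
      Real.rpow_le_rpow (by positivity) (by linarith [hrank i hi]) (by linarith)
    rw [hpc, e]
    exact div_le_div₀ (by positivity) (one_div_le_one_div_of_le (by positivity) h3)
      (zipf_denom_pos γc m) (zipf_denom_le_of_one_lt hc m)
  have hprI : ∀ i ∈ I, pr ≤ (1 - zipf γc m i) * zipf γr m i := by
    intro i hi
    have h3 : zipf γc m i ≤ 1 / 2 :=
      zipf_le_half (by linarith) (hk1.trans (Finset.mem_filter.1 hi).2.1)
    have h4 : ((i : ℝ) + 1) ^ γr ≤ (2 * (k : ℝ)) ^ γr :=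
      Real.rpow_le_rpow (by positivity) (hrank i hi) h0
    refine mul_le_mul (by linarith) ?_ (by positivity) (by linarith)
    exact div_le_div₀ (by positivity) (one_div_le_one_div_of_le (by positivity) h4)
      (zipf_denom_pos γr m) (zipf_denom_le h0 h1 m)
  have ha0 : 0 ≤ a := by rw [ha]; positivity
  have hb0 : 0 ≤ b := by rw [hb]; positivity
  have hta : a ≤ ((n / 2 : ℕ) : ℝ) * ((r / 2) ^ 2 * pc) := by
    calc a = n / 3 * (c₃ ^ 2 * (M / n) / 4 * pc) := by
          rw [ha, hpc]; field_simp; norm_num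
      _ ≤ ((n / 2 : ℕ) : ℝ) * (r ^ 2 / 4 * pc) := by gcongr
      _ = _ := by ring
  have hvb : b ≤ ((n - n / 2 : ℕ) : ℝ) * ((r / 2) ^ 2 * pr) * I.card := by
    have hkpr : (1 - γr) / (4 * M) ≤ pr * k := by
      have e1 : (2 * (k : ℝ)) ^ γr = 2 * k / (2 * (k : ℝ)) ^ (1 - γr) := by
        rw [Real.rpow_sub (by positivity), Real.rpow_one]; field_simp
      have e2 : pr * k = 1 / 4 * ((2 * (k : ℝ)) ^ (1 - γr) / (m : ℝ) ^ (1 - γr)) * (1 - γr) := by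
        rw [hpr, e1]; field_simp; norm_num
      have e3 : 1 / M ≤ (2 * (k : ℝ)) ^ (1 - γr) / (m : ℝ) ^ (1 - γr) := by
        rw [le_div_iff₀ (by positivity)]
        calc 1 / M * (m : ℝ) ^ (1 - γr) = q ^ (1 - γr) := by rw [q2]; ring
          _ ≤ (2 * (k : ℝ)) ^ (1 - γr) := by gcongr; linarith
      rw [e2]
      calc (1 - γr) / (4 * M) = 1 / 4 * (1 / M) * (1 - γr) := by ring
        _ ≤ _ := by gcongr
    rw [hIcard]
    calc b = n / 3 * (c₃ ^ 2 * (M / n) / 4) * ((1 - γr) / (4 * M)) := by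
          rw [hb]; field_simp; norm_num
      _ ≤ ((n - n / 2 : ℕ) : ℝ) * (r ^ 2 / 4) * (pr * k) := by gcongr
      _ = _ := by ring
  have hP : ∀ c ∈ Finset.range d ×ˢ Finset.range d, a / (1 + a) * (b / (1 + b)) ≤
      (networkLaw γr (zipfCaching n m γc)).real (serviceEvent n T I (separatedCell r c)) := by
    intro c hcd
    obtain ⟨hc1, hc2⟩ := Finset.mem_product.1 hcd
    refine le_trans ?_ (le_networkLaw_serviceEvent T I (measurableSet_separatedCell r c)
      (pc := pc) (pr := pr) (by positivity) (by positivity)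
      (positionLaw_separatedCell hr hdle (Finset.mem_range.1 hc1) (Finset.mem_range.1 hc2))
      hpcI hprI ht.symm hv.symm)
    exact mul_le_mul (div_one_add_le_div_one_add ha0 hta) (div_one_add_le_div_one_add hb0 hvb)
      (by positivity) (by positivity)
  refine le_trans ?_ (le_expectedActiveLinks_of_serviceEvent hr T I _ hP)
  rw [Finset.card_product, Finset.card_range, Nat.cast_mul]
  have hcount : 1 / (64 * c₄ ^ 2) * (n / M) ≤ (d : ℝ) * d := by
    calc 1 / (64 * c₄ ^ 2) * (n / M) = 1 / (64 * (c₄ ^ 2 * (M / n))) := by field_simp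
      _ ≤ 1 / (64 * r ^ 2) := by gcongr
      _ = 1 / (8 * r) * (1 / (8 * r)) := by field_simp; norm_num
      _ ≤ d * d := by gcongr
  calc _ = 1 / (64 * c₄ ^ 2) * (n / M) * (a / (1 + a) * (b / (1 + b))) := by ring
    _ ≤ _ := by gcongr

end ZipfCachingLower

end

/-! ### The theorem: solvability for `γc` and choice of constants. -/

theorem theorem2 (γr : ℝ) (hγ0 : 0 ≤ γr) (hγ1 : γr < 1)
    (m : ℕ → ℕ) (hm : Tendsto m atTop atTop)
    (hsub : (fun n : ℕ => (m n : ℝ)) =o[atTop] fun n : ℕ => (n : ℝ))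
    (η : ℝ) (hη : η = (1 - γr) / (2 - γr)) :
    -- upper bound, for every collaboration distance and every caching policy
    (∃ C : ℝ, 0 < C ∧ ∀ᶠ n : ℕ in atTop, ∀ (r : ℝ) (κ : CachingPolicy n (m n)), IsMarkovKernel κ →
      expectedActiveLinks γr r κ ≤ C * ((n : ℝ) / (m n : ℝ) ^ η)) ∧
    -- achievability
    ∀ ε : ℝ, 0 < ε → ε < 1 / 6 →
      ((∃ γc : ℝ, 0 < γc ∧ (1 - γr) * γc / (1 - γr + γc) = η + ε) ↔ η + ε < 1 - γr) ∧
      ∀ γc : ℝ, 0 < γc → (1 - γr) * γc / (1 - γr + γc) = η + ε →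
        ∀ c₃ c₄ : ℝ, 0 < c₃ → 0 < c₄ →
          ∃ A B : ℝ, 0 < A ∧ 0 < B ∧ ∀ᶠ n : ℕ in atTop, ∀ r : ℝ,
            c₃ * √((m n : ℝ) ^ (η + ε) / (n : ℝ)) ≤ r →
            r ≤ c₄ * √((m n : ℝ) ^ (η + ε) / (n : ℝ)) →
              A * ((n : ℝ) / (m n : ℝ) ^ (η + ε)) ≤
                  expectedActiveLinks γr r (zipfCaching n (m n) γc) ∧
                expectedActiveLinks γr r (zipfCaching n (m n) γc) ≤
                  B * ((n : ℝ) / (m n : ℝ) ^ (η + ε)) := by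
  have hγ : 0 < 1 - γr := by linarith
  have hη0 : 0 < η := by rw [hη]; exact div_pos hγ (by linarith)
  refine ⟨exists_forall_expectedActiveLinks_le hγ0 hγ1 hm hsub hη, fun ε hε _ => ⟨?_, ?_⟩⟩
  · constructor
    · rintro ⟨γc, hc, h⟩
      rw [← h, div_lt_iff₀ (by linarith)]
      nlinarith
    · intro h
      have hd : 0 < 1 - γr - (η + ε) := by linarith
      refine ⟨(η + ε) * (1 - γr) / (1 - γr - (η + ε)), by positivity, ?_⟩
      rw [div_eq_iff (by positivity)]
      field_simp
      ring
  intro γc hc h c₃ c₄ hc₃ hc₄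
  obtain ⟨θ, hθdef⟩ : ∃ θ, θ = η + ε := ⟨_, rfl⟩
  rw [← hθdef] at h ⊢
  have hθ0 : 0 < θ := by linarith
  have hθ : (1 - γr) * γc = θ * (1 - γr + γc) := by
    rw [← h]; field_simp
  have hθη : η * (2 - γr) = 1 - γr := by
    rw [hη]; field_simp [(by linarith : (2 - γr) ≠ 0)]
  -- The left side of the equation increases with `γc` and equals `η` at `γc = 1`; the value `η + ε`
  -- exceeds this.
  have hγc : 1 < γc := by
    by_contra hle
    push Not at hle
    have h2 : η * (1 - γr + γc) < (1 - γr) * γc := by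
      rw [hθ]
      exact mul_lt_mul_of_pos_right (by linarith) (by linarith)
    have h3 := mul_lt_mul_of_pos_right h2 (by linarith : 0 < 2 - γr)
    have h4 : (1 - γr) * (1 - γr + γc) < (1 - γr) * (γc * (2 - γr)) := by
      calc _ = η * (1 - γr + γc) * (2 - γr) := by rw [← hθη]; ring
        _ < _ := h3
        _ = _ := by ring
    have h5 := lt_of_mul_lt_mul_left h4 hγ.le
    nlinarith
  have hθ1 : θ < 1 := by
    nlinarith
  have hθc : θ / γc < 1 := by
    rw [div_lt_one hc]; linarith
  obtain ⟨a, ha⟩ : ∃ a, a = c₃ ^ 2 / (12 * 4 ^ γc * (1 + 1 / (γc - 1))) := ⟨_, rfl⟩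
  obtain ⟨b, hb⟩ : ∃ b, b = c₃ ^ 2 * (1 - γr) / 48 := ⟨_, rfl⟩
  have hγc1 : 0 < γc - 1 := by linarith
  have ha0 : 0 < a := by rw [ha]; positivity
  have hb0 : 0 < b := by rw [hb]; positivity
  have hB0 : 0 < γc + γr - 1 := by linarith
  refine ⟨1 / (64 * c₄ ^ 2) * (a / (1 + a) * (b / (1 + b))),
    4 / (1 - γr) + 4 * c₄ ^ 2 / (γc + γr - 1), by positivity, by positivity, ?_⟩
  have hmR : Tendsto (fun n => (m n : ℝ)) atTop atTop := tendsto_natCast_atTop_atTop.comp hm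
  have hmθ := (tendsto_rpow_atTop (y := 1 - θ / γc) (by linarith)).comp hmR
  -- The first condition makes room for the block of files, `4 * q ≤ m`. The last one, with `θ < 1`,
  -- gives `r ≤ 1 / 4`, so that at least one separated square fits.
  filter_upwards [hmθ.eventually_ge_atTop 4, hm.eventually_ge_atTop 1, eventually_ge_atTop 2,
    hsub.bound (by positivity : 0 < 1 / (16 * c₄ ^ 2))] with n h4 hm1 hn hmn r hr₃ hr₄
  simp only [Function.comp] at h4
  rw [Real.norm_of_nonneg (Nat.cast_nonneg _), Real.norm_of_nonneg (Nat.cast_nonneg _)] at hmn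
  have : NeZero (m n) := ⟨by omega⟩
  have hmp : (0 : ℝ) < m n := by exact_mod_cast hm1
  have hm1' : (1 : ℝ) ≤ m n := by exact_mod_cast hm1
  have hn0 : (0 : ℝ) < n := by exact_mod_cast (by omega : 0 < n)
  have hm4 : 4 * ((m n : ℝ) ^ θ) ^ (1 / γc) ≤ m n := by
    rw [← Real.rpow_mul hmp.le, mul_one_div]
    rw [Real.rpow_sub hmp, Real.rpow_one, le_div_iff₀ (by positivity)] at h4
    exact h4
  have hr4 : c₄ * √((m n : ℝ) ^ θ / n) ≤ 1 / 4 := by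
    have h2 : (m n : ℝ) ^ θ ≤ m n := by
      calc (m n : ℝ) ^ θ ≤ (m n : ℝ) ^ (1 : ℝ) :=
            Real.rpow_le_rpow_of_exponent_le hm1' hθ1.le
        _ = _ := Real.rpow_one _
    have h3 : (m n : ℝ) ^ θ / n ≤ (1 / (4 * c₄)) ^ 2 := by
      rw [div_le_iff₀ hn0]
      refine (h2.trans hmn).trans (le_of_eq ?_)
      field_simp; norm_num
    calc c₄ * √((m n : ℝ) ^ θ / n) ≤ c₄ * (1 / (4 * c₄)) := by
          gcongr
          exact Real.sqrt_le_iff.2 ⟨by positivity, h3⟩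
      _ = 1 / 4 := by field_simp
  have hr0 : 0 ≤ r := le_trans (by positivity) hr₃
  exact ⟨le_expectedActiveLinks_zipfCaching hγ0 hγ1 hγc hθ0.le hθ hn hc₃ hc₄ hm4 hr4 hr₃ hr₄ ha hb,
    expectedActiveLinks_zipfCaching_le hγ0 hγ1 hγc hθ0.le hθ (by omega) hr0 hr₄⟩
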